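/- Let $\epsilon=1/100$ and $\eta>40$. Let $H$ be a holomorphic function on the strip $|\mathrm{Re}\,\mu|<2\eta$ with $H(-\mu)=H(\mu)$ and $H(\mu)\ll e^{-2\pi|\mu|}$ there. Let $\alpha_1,\alpha_2,\alpha_3\in\mathbb{C}$ be distinct, with $\alpha_1+\alpha_2+\alpha_3=0$ and $|\alpha_1|,|\alpha_2|<\epsilon/1000$. Let $\Lambda(s)=\pi^{-s/2}\Gamma(s/2)\zeta(s)$ be the completed Riemann zeta function, and put $$(\mathcal{C}_\alpha H)(s)=\int_{(0)}H(\mu)\,\frac{\prod_{i=1}^{3}\Lambda(s+\mu-\alpha_i)\Lambda(s-\mu-\alpha_i)}{\Lambda(1+2\mu)\Lambda(1-2\mu)}\,\frac{d\mu}{2\pi i},$$ the integral being taken upwards along the line $\mathrm{Re}\,\mu=0$, and $$(\mathcal{R}_\alpha H)(s)=2\sum_{i=1}^{3}H(1-s+\alpha_i)\,\frac{\prod_{1\le j\le 3,\ j\ne i}\Lambda(1+\alpha_i-\alpha_j)\,\Lambda(2s-1-\alpha_i-\alpha_j)}{\Lambda(3-2s+2\alpha_i)}.$$ The integral $(\mathcal{C}_\alpha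 H)(s)$ converges absolutely both for $\mathrm{Re}\,s>1+\max_i\mathrm{Re}\,\alpha_i$ and for $\epsilon<\mathrm{Re}\,s<1-\epsilon$. The function $s\mapsto(\mathcal{C}_\alpha H)(s)$, which is holomorphic on $\mathrm{Re}\,s>1+\max_i\mathrm{Re}\,\alpha_i$, has a meromorphic continuation from that half-plane to the half-plane $\mathrm{Re}\,s>\epsilon$. On the strip $\epsilon<\mathrm{Re}\,s<1-\epsilon$ this continuation is equal to $(\mathcal{R}_\alpha H)(s)+(\mathcal{C}_\alpha H)(s)$, with $(\mathcal{C}_\alpha H)(s)$ still given by the integral above, for every $s$ other than the possible poles $s=(1-\alpha_k)/2$, $k=1,2,3$. -/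

import Mathlib

/-- The class of test functions on the strip `|Re μ| < 2η`: holomorphic, even, and of size
`O(exp (-2π|μ|))` on the whole strip. -/
structure IsTestFunction (η : ℝ) (H : ℂ → ℂ) : Prop where
  holomorphic : DifferentiableOn ℂ H {μ : ℂ | |μ.re| < 2 * η}
  even : ∀ μ : ℂ, |μ.re| < 2 * η → H (-μ) = H μ
  decay : ∃ C : ℝ, ∀ μ : ℂ, |μ.re| < 2 * η → ‖H μ‖ ≤ C * Real.exp (-(2 * Real.pi * ‖μ‖))

/-- The integrand of the continuous spectrum. Mathlib's `completedRiemannZeta` is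
`Λ(s) = π^(-s/2) Γ(s/2) ζ(s)`. -/
noncomputable def contIntegrand (α : Fin 3 → ℂ) (H : ℂ → ℂ) (s μ : ℂ) : ℂ :=
  H μ * (∏ i : Fin 3, completedRiemannZeta (s + μ - α i) * completedRiemannZeta (s - μ - α i)) /
    (completedRiemannZeta (1 + 2 * μ) * completedRiemannZeta (1 - 2 * μ))

/-- The integral of `contIntegrand` along the line `Re μ = 0`, upwards, against `dμ / (2πi)`,
with `μ = i t` and `dμ = i dt`. -/
noncomputable def contSpectrum (α : Fin 3 → ℂ) (H : ℂ → ℂ) (s : ℂ) : ℂ :=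
  (1 / (2 * (Real.pi : ℂ) * Complex.I)) *
    ∫ t : ℝ, contIntegrand α H s ((t : ℂ) * Complex.I) * Complex.I

/-- The residual term. -/
noncomputable def residualTerm (α : Fin 3 → ℂ) (H : ℂ → ℂ) (s : ℂ) : ℂ :=
  2 * ∑ i : Fin 3, H (1 - s + α i) *
    (∏ j ∈ Finset.univ.erase i,
      completedRiemannZeta (1 + α i - α j) * completedRiemannZeta (2 * s - 1 - α i - α j)) /
    completedRiemannZeta (3 - 2 * s + 2 * α i)

/-- `F` is a meromorphic continuation to the domain `U` of the holomorphic function `f` on the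
nonempty open subset `V` of `U`. -/
structure IsMeromorphicContinuation (f : ℂ → ℂ) (V : Set ℂ) (F : ℂ → ℂ) (U : Set ℂ) : Prop where
  isOpen_source : IsOpen V
  nonempty_source : V.Nonempty
  isOpen_target : IsOpen U
  isPreconnected_target : IsPreconnected U
  subset : V ⊆ U
  holomorphic : DifferentiableOn ℂ f V
  meromorphic : MeromorphicOn F U
  eqOn : Set.EqOn F f V

/-!
For fixed `s` the integrand of the continuous spectrum has its poles near `Re μ = 0` at
`μ = ±p i`, where `p i = s - 1 - α i`, and these cross the path of integration as `s` moves from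
the right half-plane into the strip. With `μ = it` they are the zeros of `∏ i, ((p i)² + t²)`.
What remains is the rapidly decaying holomorphic kernel `regularKernel`: the decay of `H` beats the
growth of `1 / (Λ(1 + 2it) Λ(1 - 2it))`, by the 3-4-1 lower bound for `ζ(1 + it)`. After a partial
fraction expansion it is enough to continue `∫ K(it) / ((p i)² + t²) dt` for each `i`. Replacing
`K(it)` by `K(it) - K(p i)` makes the integral holomorphic across `Re (p i) = 0`, and the
subtracted term is explicit, because `∫ dt / (p² + t²) = ±π / p` according to the sign of `Re p`.
The jump between the two signs is the residue of the integrand, hence a summand of the residual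
term.
-/

open Filter Topology MeasureTheory

lemma aestronglyMeasurable_deriv_param {X E : Type*} [MeasurableSpace X] {ν : Measure X}
    [NormedAddCommGroup E] [NormedSpace ℂ E] {g : ℂ → X → E} {s₀ : ℂ}
    (hmeas : ∀ᶠ s in 𝓝 s₀, AEStronglyMeasurable (g s) ν)
    (hd : ∀ᵐ x ∂ν, DifferentiableAt ℂ (fun s => g s x) s₀) :
    AEStronglyMeasurable (fun x => deriv (fun s => g s x) s₀) ν := by
  obtain ⟨u, hu⟩ := exists_seq_tendsto (𝓝[≠] s₀)
  obtain ⟨N, hN⟩ := eventually_atTop.mp ((hu.mono_right nhdsWithin_le_nhds).eventually hmeas)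
  refine aestronglyMeasurable_of_tendsto_ae atTop
    (f := fun n x => slope (fun s => g s x) s₀ (u (n + N))) (fun n => ?_) ?_
  · exact ((hN _ (by omega)).sub hmeas.self_of_nhds).const_smul (u (n + N) - s₀)⁻¹
  · filter_upwards [hd] with x hx
    exact (hasDerivAt_iff_tendsto_slope.mp hx.hasDerivAt).comp
      (hu.comp (tendsto_add_atTop_nat N))

theorem analyticAt_integral_of_dominated {X E : Type*} [MeasurableSpace X] {ν : Measure X}
    [NormedAddCommGroup E] [NormedSpace ℂ E] [CompleteSpace E] {g : ℂ → X → E} {s₀ : ℂ}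
    {U : Set ℂ} (hU : U ∈ 𝓝 s₀) {b : X → ℝ} (hmeas : ∀ s ∈ U, AEStronglyMeasurable (g s) ν)
    (hd : ∀ᵐ x ∂ν, DifferentiableOn ℂ (fun s => g s x) U)
    (hb : ∀ᵐ x ∂ν, ∀ s ∈ U, ‖g s x‖ ≤ b x) (hbi : Integrable b ν) :
    AnalyticAt ℂ (fun s => ∫ x, g s x ∂ν) s₀ := by
  obtain ⟨r, hr, hrU⟩ := Metric.mem_nhds_iff.mp hU
  rw [Complex.analyticAt_iff_eventually_differentiableAt]
  filter_upwards [Metric.ball_mem_nhds s₀ (half_pos hr)] with s₁ hs₁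
  have hρ : 0 < r / 4 := by positivity
  have hsub : ∀ z ∈ Metric.ball s₁ (r / 4), Metric.closedBall z (r / 4) ⊆ U := by
    refine fun z hz => (Metric.closedBall_subset_ball' ?_).trans hrU
    rw [Metric.mem_ball] at hz hs₁
    linarith [dist_triangle z s₁ s₀]
  have hUz : ∀ z ∈ Metric.ball s₁ (r / 4), U ∈ 𝓝 z := fun z hz =>
    mem_of_superset (Metric.closedBall_mem_nhds z hρ) (hsub z hz)
  have hU₁ : U ∈ 𝓝 s₁ := hUz s₁ (Metric.mem_ball_self hρ)
  refine (hasDerivAt_integral_of_dominated_loc_of_deriv_le (s := Metric.ball s₁ (r / 4))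
    (F' := fun s x => deriv (fun s => g s x) s) (bound := fun x => b x / (r / 4))
    (Metric.ball_mem_nhds _ hρ) ?_ ?_ ?_ ?_ (hbi.div_const _) ?_).2.differentiableAt
  · filter_upwards [hU₁] with s hs using hmeas s hs
  · exact hbi.mono' (hmeas s₁ (mem_of_mem_nhds hU₁))
      (hb.mono fun x hx => hx s₁ (mem_of_mem_nhds hU₁))
  · refine aestronglyMeasurable_deriv_param ?_ (hd.mono fun x hx => hx.differentiableAt hU₁)
    filter_upwards [hU₁] with s hs using hmeas s hs
  · filter_upwards [hd, hb] with x hx hbx z hz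
    exact Complex.norm_deriv_le_of_forall_mem_sphere_norm_le hρ
      ((hx.mono (hsub z hz)).diffContOnCl_ball subset_rfl)
      fun w hw => hbx w (hsub z hz (Metric.sphere_subset_closedBall hw))
  · filter_upwards [hd] with x hx z hz
    exact (hx.differentiableAt (hUz z hz)).hasDerivAt

/-- The tail integral `∫₁^∞ {t} t^(-s-1) dt` that measures the failure of
`ζ(s) = s / (s - 1)`; it converges for `Re s > 0`. -/
noncomputable def fractIntegral (s : ℂ) : ℂ :=
  ∫ t in Set.Ioi (1 : ℝ), ((Int.fract t : ℝ) : ℂ) * (t : ℂ) ^ (-(s + 1))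

lemma norm_fract_mul_cpow_le {σ : ℝ} {s : ℂ} (hs : σ ≤ s.re) {t : ℝ} (ht : 1 < t) :
    ‖((Int.fract t : ℝ) : ℂ) * (t : ℂ) ^ (-(s + 1))‖ ≤ t ^ (-(σ + 1)) := by
  rw [norm_mul, Complex.norm_real, Real.norm_of_nonneg (Int.fract_nonneg t),
    Complex.norm_cpow_eq_rpow_re_of_pos (zero_lt_one.trans ht)]
  refine (mul_le_of_le_one_left (by positivity) (Int.fract_lt_one t).le).trans ?_
  exact Real.rpow_le_rpow_of_exponent_le ht.le (by simp; linarith)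

lemma integrableOn_rpow_neg_add_one {σ : ℝ} (hσ : 0 < σ) :
    IntegrableOn (fun t : ℝ => t ^ (-(σ + 1))) (Set.Ioi 1) :=
  integrableOn_Ioi_rpow_of_lt (by linarith) zero_lt_one

lemma aestronglyMeasurable_fract_mul_cpow (s : ℂ) :
    AEStronglyMeasurable (fun t : ℝ => ((Int.fract t : ℝ) : ℂ) * (t : ℂ) ^ (-(s + 1)))
      (volume.restrict (Set.Ioi 1)) :=
  (Complex.measurable_ofReal.comp measurable_fract).mul
    (Complex.measurable_ofReal.pow_const _) |>.aestronglyMeasurable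

lemma integrableOn_fract_mul_cpow {s : ℂ} (hs : 0 < s.re) :
    IntegrableOn (fun t : ℝ => ((Int.fract t : ℝ) : ℂ) * (t : ℂ) ^ (-(s + 1))) (Set.Ioi 1) :=
  (integrableOn_rpow_neg_add_one hs).mono' (aestronglyMeasurable_fract_mul_cpow s) <|
    (ae_restrict_mem measurableSet_Ioi).mono fun _ ht => norm_fract_mul_cpow_le le_rfl ht

lemma norm_fractIntegral_le {s : ℂ} (hs : 0 < s.re) : ‖fractIntegral s‖ ≤ 1 / s.re := by
  refine (norm_integral_le_of_norm_le (integrableOn_rpow_neg_add_one hs) <|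
    (ae_restrict_mem measurableSet_Ioi).mono fun _ ht =>
      norm_fract_mul_cpow_le le_rfl ht).trans_eq ?_
  rw [integral_Ioi_rpow_of_lt (by linarith) zero_lt_one, Real.one_rpow]
  ring

lemma analyticAt_fractIntegral {s₀ : ℂ} (hs₀ : 0 < s₀.re) : AnalyticAt ℂ fractIntegral s₀ := by
  refine analyticAt_integral_of_dominated (U := {s | s₀.re / 2 < s.re})
    ((isOpen_lt continuous_const Complex.continuous_re).mem_nhds (half_lt_self hs₀))
    (fun s _ => aestronglyMeasurable_fract_mul_cpow s) ?_ ?_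
    (integrableOn_rpow_neg_add_one (half_pos hs₀))
  · filter_upwards [ae_restrict_mem measurableSet_Ioi] with t ht
    have ht₀ : (t : ℂ) ≠ 0 := Complex.ofReal_ne_zero.mpr (zero_lt_one.trans ht).ne'
    fun_prop (disch := simp [ht₀])
  · filter_upwards [ae_restrict_mem measurableSet_Ioi] with t ht s hs
    exact norm_fract_mul_cpow_le (le_of_lt hs) ht

lemma riemannZeta_eq_sub_fractIntegral {s : ℂ} (hs : 1 < s.re) :
    riemannZeta s = s / (s - 1) - s * fractIntegral s := by
  have hζ : riemannZeta s = s * ∫ t in Set.Ioi (1 : ℝ),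
      (∑ _k ∈ Finset.Icc 1 ⌊t⌋₊, ((1 : ℝ) : ℂ)) * (t : ℂ) ^ (-(s + 1)) := by
    rw [← LSeries_one_eq_riemannZeta hs, ← LSeries_eq_mul_integral_of_nonneg (fun _ => (1 : ℝ))
      zero_le_one hs (by simpa using Asymptotics.isBigO_refl (fun n : ℕ => (n : ℝ)) atTop)
      fun _ => zero_le_one]
    simp only [Complex.ofReal_one, Pi.one_def]
  have hfloor : ∀ t ∈ Set.Ioi (1 : ℝ),
      (∑ _k ∈ Finset.Icc 1 ⌊t⌋₊, ((1 : ℝ) : ℂ)) * (t : ℂ) ^ (-(s + 1)) =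
        (t : ℂ) ^ (-s) - ((Int.fract t : ℝ) : ℂ) * (t : ℂ) ^ (-(s + 1)) := by
    intro t (ht : 1 < t)
    have ht₀ : (t : ℂ) ≠ 0 := Complex.ofReal_ne_zero.mpr (zero_lt_one.trans ht).ne'
    have hcard : ((⌊t⌋₊ : ℝ) : ℂ) = t - Int.fract t := by
      rw [natCast_floor_eq_intCast_floor (zero_le_one.trans ht.le), ← Int.self_sub_fract,
        Complex.ofReal_sub]
    have hpow : (t : ℂ) ^ (-s) = t * (t : ℂ) ^ (-(s + 1)) := by
      rw [show -s = 1 + -(s + 1) by ring, Complex.cpow_add _ _ ht₀, Complex.cpow_one]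
    simp only [Complex.ofReal_one, Finset.sum_const, Nat.card_Icc, add_tsub_cancel_right,
      nsmul_eq_mul, mul_one]
    rw [hpow, ← sub_mul, ← hcard, Complex.ofReal_natCast]
  have hpole : ∫ t in Set.Ioi (1 : ℝ), (t : ℂ) ^ (-s) = 1 / (s - 1) := by
    rw [integral_Ioi_cpow_of_lt (by simpa using hs) zero_lt_one, Complex.ofReal_one,
      Complex.one_cpow, show -s + 1 = -(s - 1) by ring, neg_div_neg_eq]
  rw [hζ, setIntegral_congr_fun measurableSet_Ioi hfloor, integral_sub
    (integrableOn_Ioi_cpow_of_lt (by simpa using hs) zero_lt_one)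
    (integrableOn_fract_mul_cpow (zero_lt_one.trans hs)), hpole, fractIntegral]
  ring

theorem riemannZeta₁_eq_sub_fractIntegral {s : ℂ} (hs : 0 < s.re) :
    riemannZeta₁ s = s - s * (s - 1) * fractIntegral s := by
  have hright : AnalyticOnNhd ℂ (fun s => s - s * (s - 1) * fractIntegral s) {s | 0 < s.re} :=
    fun s hs => by have := analyticAt_fractIntegral hs; fun_prop
  refine (differentiable_riemannZeta₁.differentiableOn.analyticOnNhd
    (isOpen_lt continuous_const Complex.continuous_re)).eqOn_of_preconnected_of_eventuallyEq
    hright (convex_halfSpace_re_gt 0).isPreconnected (show (2 : ℂ) ∈ {s : ℂ | 0 < s.re} by simp)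
    ?_ hs
  have hhalf : {s : ℂ | 1 < s.re} ∈ 𝓝 (2 : ℂ) :=
    (isOpen_lt continuous_const Complex.continuous_re).mem_nhds (by simp)
  filter_upwards [hhalf] with s (hs : 1 < s.re)
  have hs₁ : s ≠ 1 := fun h => by simp [h] at hs
  have hζ := riemannZeta_eq_sub_fractIntegral hs
  rw [riemannZeta_eq_inv_sub_mul hs₁] at hζ
  have := sub_ne_zero.mpr hs₁
  field_simp at hζ
  linear_combination hζ

lemma norm_riemannZeta₁_le {s : ℂ} (hs : 1 / 2 ≤ s.re) :
    ‖riemannZeta₁ s‖ ≤ ‖s‖ * (3 + 2 * ‖s‖) := by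
  have hfract : ‖fractIntegral s‖ ≤ 2 :=
    (norm_fractIntegral_le (by linarith)).trans (by rw [div_le_iff₀] <;> linarith)
  have hsub : ‖s - 1‖ ≤ ‖s‖ + 1 := by simpa using norm_sub_le s 1
  rw [riemannZeta₁_eq_sub_fractIntegral (by linarith)]
  calc ‖s - s * (s - 1) * fractIntegral s‖
      ≤ ‖s‖ + ‖s‖ * ‖s - 1‖ * ‖fractIntegral s‖ := by
        simpa only [norm_mul] using norm_sub_le s (s * (s - 1) * fractIntegral s)
    _ ≤ ‖s‖ + ‖s‖ * (‖s‖ + 1) * 2 := by gcongr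
    _ = ‖s‖ * (3 + 2 * ‖s‖) := by ring

lemma norm_deriv_riemannZeta₁_le {s : ℂ} (hs : 1 ≤ s.re) :
    ‖deriv riemannZeta₁ s‖ ≤ 18 * ‖s‖ ^ 2 := by
  have hs₁ : 1 ≤ ‖s‖ := hs.trans (Complex.re_le_norm s)
  refine (Complex.norm_deriv_le_of_forall_mem_sphere_norm_le (R := 1 / 2)
    (C := 9 * ‖s‖ ^ 2) (by norm_num)
    differentiable_riemannZeta₁.diffContOnCl fun z hz => ?_).trans_eq (by ring)
  rw [mem_sphere_iff_norm] at hz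
  have hre : 1 / 2 ≤ z.re := by
    have := (abs_le.mp ((Complex.abs_re_le_norm (z - s)).trans_eq hz)).1
    rw [Complex.sub_re] at this
    linarith
  have hnorm : ‖z‖ ≤ ‖s‖ + 1 / 2 := by linarith [norm_le_norm_add_norm_sub' z s]
  calc ‖riemannZeta₁ z‖ ≤ ‖z‖ * (3 + 2 * ‖z‖) := norm_riemannZeta₁_le hre
    _ ≤ (‖s‖ + 1 / 2) * (3 + 2 * (‖s‖ + 1 / 2)) := by gcongr
    _ ≤ 9 * ‖s‖ ^ 2 := by nlinarith

lemma norm_riemannZeta₁_one_add_sub_le {x y : ℝ} (hx : 0 ≤ x) (hx₁ : x ≤ 1) (hy : 1 ≤ |y|) :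
    ‖riemannZeta₁ (1 + x + Complex.I * y) - riemannZeta₁ (1 + Complex.I * y)‖ ≤
      162 * y ^ 2 * x := by
  set D : Set ℂ := {s | 1 ≤ s.re} ∩ Metric.closedBall 0 (3 * |y|)
  have hmem : ∀ u : ℝ, 0 ≤ u → u ≤ 1 → 1 + u + Complex.I * y ∈ D := fun u hu hu₁ => by
    refine ⟨by simpa using hu, mem_closedBall_zero_iff.mpr ((norm_add₃_le).trans ?_)⟩
    rw [norm_one, norm_mul, Complex.norm_I, Complex.norm_real, Complex.norm_real,
      Real.norm_of_nonneg hu, Real.norm_eq_abs]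
    linarith
  have hderiv : ∀ s ∈ D, ‖deriv riemannZeta₁ s‖ ≤ 162 * y ^ 2 := fun s ⟨hre, hs⟩ =>
    calc ‖deriv riemannZeta₁ s‖ ≤ 18 * ‖s‖ ^ 2 := norm_deriv_riemannZeta₁_le hre
      _ ≤ 18 * (3 * |y|) ^ 2 := by gcongr; exact mem_closedBall_zero_iff.mp hs
      _ = 162 * y ^ 2 := by rw [mul_pow, sq_abs]; ring
  have h := ((convex_halfSpace_re_ge 1).inter
    (convex_closedBall 0 (3 * |y|))).norm_image_sub_le_of_norm_deriv_le
    (fun s _ => differentiable_riemannZeta₁ s) hderiv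
    (by simpa using hmem 0 le_rfl zero_le_one) (hmem x hx hx₁)
  rwa [show 1 + x + Complex.I * y - (1 + Complex.I * y) = (x : ℂ) by ring, Complex.norm_real,
    Real.norm_of_nonneg hx] at h

lemma norm_riemannZeta₁_product_ge {x : ℝ} (hx : 0 < x) (y : ℝ) :
    x ^ 3 * ‖(x : ℂ) + Complex.I * y‖ ^ 4 * ‖(x : ℂ) + 2 * Complex.I * y‖ ≤
      ‖riemannZeta₁ (1 + x)‖ ^ 3 * ‖riemannZeta₁ (1 + x + Complex.I * y)‖ ^ 4 *
        ‖riemannZeta₁ (1 + x + 2 * Complex.I * y)‖ := by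
  have hζ : ∀ w : ℂ, 0 < w.re →
      ‖riemannZeta (1 + w)‖ = ‖w‖⁻¹ * ‖riemannZeta₁ (1 + w)‖ := fun w hw => by
    have hw₀ : w ≠ 0 := fun h => by simp [h] at hw
    rw [riemannZeta_eq_inv_sub_mul (by simpa), norm_mul, norm_inv, add_sub_cancel_left]
  have h := DirichletCharacter.norm_LFunction_product_ge_one (N := 1) 1 hx y
  simp only [DirichletCharacter.LFunctionTrivChar, DirichletCharacter.LFunction_modOne_eq,
    norm_mul, norm_pow, add_assoc] at h
  rw [hζ _ (by simpa), hζ _ (by simpa), hζ _ (by simpa), Complex.norm_real,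
    Real.norm_of_nonneg hx.le] at h
  have hpos : ∀ v : ℝ, 0 < ‖(x : ℂ) + v * Complex.I‖ := fun v =>
    norm_pos_iff.mpr fun h => hx.ne' (by simpa using congrArg Complex.re h)
  have h₁ : 0 < ‖(x : ℂ) + Complex.I * y‖ := by simpa [mul_comm] using hpos y
  have h₂ : 0 < ‖(x : ℂ) + 2 * Complex.I * y‖ := by
    convert hpos (2 * y) using 3; push_cast; ring
  simp only [add_assoc]
  generalize ‖(x : ℂ) + Complex.I * y‖ = a, ‖(x : ℂ) + 2 * Complex.I * y‖ = b at *
  rw [ge_iff_le, ← mul_le_mul_iff_of_pos_left (show 0 < x ^ 3 * a ^ 4 * b by positivity),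
    mul_one] at h
  exact h.trans_eq (by field_simp)

lemma norm_riemannZeta₁_one_add_le {x y : ℝ} (hx : 0 ≤ x) (hx₁ : x ≤ 1) :
    ‖riemannZeta₁ (1 + x + Complex.I * y)‖ ≤ (2 + |y|) * (7 + 2 * |y|) := by
  have hnorm : ‖1 + (x : ℂ) + Complex.I * y‖ ≤ 2 + |y| := by
    refine norm_add₃_le.trans ?_
    rw [norm_one, norm_mul, Complex.norm_I, Complex.norm_real, Complex.norm_real,
      Real.norm_of_nonneg hx, Real.norm_eq_abs]
    linarith
  exact (norm_riemannZeta₁_le (by simp; linarith)).trans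
    (mul_le_mul hnorm (by linarith) (by positivity) (by positivity))

lemma pow_three_mul_le_norm_riemannZeta₁_pow_four {x y : ℝ} (hx : 0 < x) (hx₁ : x ≤ 1)
    (hy : 1 ≤ |y|) :
    x ^ 3 * |y| ^ 3 ≤ 14 ^ 4 * 2 * ‖riemannZeta₁ (1 + x + Complex.I * y)‖ ^ 4 := by
  have : 0 < |y| := by linarith
  have hreal : ‖riemannZeta₁ (1 + x)‖ ≤ 14 := by
    simpa using (norm_riemannZeta₁_one_add_le (y := 0) hx.le hx₁).trans_eq (by norm_num)
  have hdouble : ‖riemannZeta₁ (1 + x + 2 * Complex.I * y)‖ ≤ 56 * |y| ^ 2 := by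
    have h := norm_riemannZeta₁_one_add_le (y := 2 * y) hx.le hx₁
    rw [abs_mul, abs_two, Complex.ofReal_mul, Complex.ofReal_ofNat, ← mul_assoc,
      mul_comm Complex.I] at h
    nlinarith
  have him : ∀ v : ℝ, |v| ≤ ‖(x : ℂ) + v * Complex.I‖ := fun v => by
    simpa using Complex.abs_im_le_norm ((x : ℂ) + v * Complex.I)
  have h₁ : |y| ≤ ‖(x : ℂ) + Complex.I * y‖ := by simpa only [mul_comm] using him y
  have h₂ : 2 * |y| ≤ ‖(x : ℂ) + 2 * Complex.I * y‖ := by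
    have h := him (2 * y)
    rwa [abs_mul, abs_two, Complex.ofReal_mul, Complex.ofReal_ofNat, mul_right_comm] at h
  have h := calc
    x ^ 3 * |y| ^ 4 * (2 * |y|)
      ≤ x ^ 3 * ‖(x : ℂ) + Complex.I * y‖ ^ 4 * ‖(x : ℂ) + 2 * Complex.I * y‖ := by gcongr
    _ ≤ _ := norm_riemannZeta₁_product_ge hx y
    _ ≤ 14 ^ 3 * ‖riemannZeta₁ (1 + x + Complex.I * y)‖ ^ 4 * (56 * |y| ^ 2) := by gcongr
  rw [← mul_le_mul_iff_of_pos_right (show 0 < 2 * |y| ^ 2 by positivity)]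
  linear_combination h

lemma exists_le_norm_riemannZeta₁_of_one_le_abs :
    ∃ c > 0, ∀ y : ℝ, 1 ≤ |y| → c ≤ |y| ^ 3 * ‖riemannZeta₁ (1 + Complex.I * y)‖ := by
  -- The distance from the line is chosen so that the lower bound from the 3-4-1 inequality is
  -- twice the variation allowed by the derivative bound.
  set δ : ℝ := 1 / (324 ^ 4 * (14 ^ 4 * 2)) with hδ
  refine ⟨162 * δ, by positivity, fun y hy => ?_⟩
  have : 0 < |y| := by linarith
  set x : ℝ := δ / |y| ^ 5 with hx
  have hx₀ : 0 < x := by positivity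
  have hx₁ : x ≤ 1 := div_le_one_of_le₀
    ((by norm_num [hδ] : δ ≤ 1).trans (one_le_pow₀ hy)) (by positivity)
  have hvar := norm_riemannZeta₁_one_add_sub_le hx₀.le hx₁ hy
  have hlower : 324 * δ / |y| ^ 3 ≤ ‖riemannZeta₁ (1 + x + Complex.I * y)‖ := by
    refine le_of_pow_le_pow_left₀ four_ne_zero (norm_nonneg _) ?_
    rw [← mul_le_mul_iff_of_pos_left (show (0 : ℝ) < 14 ^ 4 * 2 by norm_num)]
    refine Eq.trans_le ?_ (pow_three_mul_le_norm_riemannZeta₁_pow_four hx₀ hx₁ hy)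
    rw [hx]
    field_simp
    rw [hδ]
    norm_num
  have hstep : 162 * y ^ 2 * x = 162 * δ / |y| ^ 3 := by
    rw [hx, ← sq_abs]
    field_simp
  have htri := norm_le_norm_add_norm_sub' (riemannZeta₁ (1 + x + Complex.I * y))
    (riemannZeta₁ (1 + Complex.I * y))
  rw [← div_le_iff₀' (by positivity)]
  linarith [show 324 * δ / |y| ^ 3 = 162 * δ / |y| ^ 3 + 162 * δ / |y| ^ 3 by ring]

lemma riemannZeta₁_ne_zero_of_one_le_re {s : ℂ} (hs : 1 ≤ s.re) : riemannZeta₁ s ≠ 0 := by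
  rcases eq_or_ne s 1 with rfl | h
  · simp
  · have hζ := riemannZeta_ne_zero_of_one_le_re hs
    rw [riemannZeta_eq_inv_sub_mul h] at hζ
    exact right_ne_zero_of_mul hζ

theorem exists_le_norm_riemannZeta₁_one_add_I_mul :
    ∃ c > 0, ∀ y : ℝ, c ≤ (1 + |y|) ^ 3 * ‖riemannZeta₁ (1 + Complex.I * y)‖ := by
  obtain ⟨c₁, hc₁, hlarge⟩ := exists_le_norm_riemannZeta₁_of_one_le_abs
  have hcont : Continuous fun y : ℝ => ‖riemannZeta₁ (1 + Complex.I * y)‖ :=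
    (differentiable_riemannZeta₁.continuous.comp (by fun_prop)).norm
  obtain ⟨y₀, -, hmin⟩ := isCompact_Icc.exists_isMinOn
    (Set.nonempty_Icc.mpr (by norm_num : (-1 : ℝ) ≤ 1)) hcont.continuousOn
  refine ⟨min c₁ ‖riemannZeta₁ (1 + Complex.I * y₀)‖, lt_min hc₁ (norm_pos_iff.mpr
    (riemannZeta₁_ne_zero_of_one_le_re (by simp))), fun y => ?_⟩
  rcases le_total |y| 1 with hy | hy
  · have hpow : 1 ≤ (1 + |y|) ^ 3 := one_le_pow₀ (by linarith [abs_nonneg y])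
    exact (min_le_right _ _).trans ((hmin (abs_le.mp hy)).trans
      (le_mul_of_one_le_left (norm_nonneg _) hpow))
  · refine (min_le_left _ _).trans ((hlarge y hy).trans ?_)
    gcongr
    linarith

lemma exists_norm_mellin_le {E : Type*} [NormedAddCommGroup E] [NormedSpace ℂ E] {f : ℝ → E}
    {a b : ℝ} (ha : MellinConvergent f a) (hb : MellinConvergent f b) :
    ∃ C : ℝ, ∀ s : ℂ, a ≤ s.re → s.re ≤ b → ‖mellin f s‖ ≤ C := by
  refine ⟨_, fun s h₁ h₂ => norm_integral_le_of_norm_le (ha.norm.add hb.norm) ?_⟩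
  filter_upwards [ae_restrict_mem measurableSet_Ioi] with t (ht : 0 < t)
  simp only [Pi.add_apply, norm_smul, Complex.norm_cpow_eq_rpow_re_of_pos ht, Complex.sub_re,
    Complex.one_re, Complex.ofReal_re, ← add_mul]
  gcongr
  have ha₀ := Real.rpow_nonneg ht.le (a - 1)
  have hb₀ := Real.rpow_nonneg ht.le (b - 1)
  rcases le_total 1 t with h | h
  · linarith [Real.rpow_le_rpow_of_exponent_le h (by linarith : s.re - 1 ≤ b - 1)]
  · linarith [Real.rpow_le_rpow_of_exponent_ge ht h (by linarith : a - 1 ≤ s.re - 1)]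

lemma exists_norm_completedRiemannZeta₀_le (a b : ℝ) :
    ∃ C : ℝ, ∀ s : ℂ, a ≤ s.re → s.re ≤ b → ‖completedRiemannZeta₀ s‖ ≤ C := by
  have hconv : ∀ s : ℂ, MellinConvergent (HurwitzZeta.hurwitzEvenFEPair 0).f_modif s := fun s =>
    ((HurwitzZeta.hurwitzEvenFEPair 0).isStrongFEPair_toStrongFEPair.hasMellin s).1
  obtain ⟨C, hC⟩ := exists_norm_mellin_le (hconv (a / 2 : ℝ)) (hconv (b / 2 : ℝ))
  refine ⟨C / 2, fun s h₁ h₂ => ?_⟩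
  have hmellin : completedRiemannZeta₀ s =
    mellin (HurwitzZeta.hurwitzEvenFEPair 0).f_modif (s / 2) / 2 := rfl
  have hre : (s / 2).re = s.re / 2 := by simp
  rw [hmellin, norm_div, Complex.norm_ofNat]
  exact div_le_div_of_nonneg_right (hC (s / 2) (by linarith) (by linarith)) zero_le_two

/-- The function `(z - 1) Λ(z)` with its removable singularity at `z = 1` filled in; its only pole
is `z = 0`. Writing it through the entire function `Λ₀` makes both facts visible. -/
noncomputable def regularizedZeta (z : ℂ) : ℂ :=
  (z - 1) * completedRiemannZeta₀ z - (z - 1) / z + 1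

lemma regularizedZeta_of_ne_one {z : ℂ} (hz : z ≠ 1) :
    regularizedZeta z = (z - 1) * completedRiemannZeta z := by
  have h : 1 - z ≠ 0 := sub_ne_zero.mpr hz.symm
  have hone : (z - 1) * (1 / (1 - z)) = -1 := by field_simp; ring
  rw [completedRiemannZeta_eq, regularizedZeta, mul_sub, mul_sub, hone]
  ring

lemma regularizedZeta_one : regularizedZeta 1 = 1 := by
  simp [regularizedZeta]

lemma regularizedZeta_eq_Gammaℝ_mul {z : ℂ} (hz : 0 < z.re) :
    regularizedZeta z = Complex.Gammaℝ z * riemannZeta₁ z := by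
  rcases eq_or_ne z 1 with rfl | h
  · simp [regularizedZeta_one, Complex.Gammaℝ_one]
  · have hζ := riemannZeta_def_of_ne_zero (Complex.ne_zero_of_re_pos hz)
    have hΓ := Complex.Gammaℝ_ne_zero_of_re_pos hz
    have h₁ := sub_ne_zero.mpr h
    rw [riemannZeta_eq_inv_sub_mul h] at hζ
    rw [regularizedZeta_of_ne_one h]
    field_simp at hζ
    linear_combination -hζ

lemma regularizedZeta_ne_zero {z : ℂ} (hz : 1 ≤ z.re) : regularizedZeta z ≠ 0 := by
  have hz₀ : 0 < z.re := zero_lt_one.trans_le hz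
  rw [regularizedZeta_eq_Gammaℝ_mul hz₀]
  exact mul_ne_zero (Complex.Gammaℝ_ne_zero_of_re_pos hz₀) (riemannZeta₁_ne_zero_of_one_le_re hz)

lemma analyticAt_completedRiemannZeta₀ (z : ℂ) : AnalyticAt ℂ completedRiemannZeta₀ z :=
  differentiable_completedZeta₀.analyticAt z

lemma analyticAt_regularizedZeta {z : ℂ} (hz : z ≠ 0) : AnalyticAt ℂ regularizedZeta z := by
  have := analyticAt_completedRiemannZeta₀ z
  unfold regularizedZeta
  fun_prop (disch := assumption)

lemma meromorphicAt_regularizedZeta (z : ℂ) : MeromorphicAt regularizedZeta z := by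
  have := (analyticAt_completedRiemannZeta₀ z).meromorphicAt
  unfold regularizedZeta
  fun_prop

lemma eventually_regularizedZeta_ne_zero (z₀ : ℂ) :
    ∀ᶠ z in 𝓝[≠] z₀, regularizedZeta z ≠ 0 := by
  set g : ℂ → ℂ := fun z => z * (z - 1) * completedRiemannZeta₀ z + 1 with hg
  have hgd : Differentiable ℂ g := by
    have := differentiable_completedZeta₀
    fun_prop
  have hg₀ : ∀ᶠ z in 𝓝[≠] z₀, g z ≠ 0 := by
    refine (hgd.analyticAt z₀).eventually_eq_zero_or_eventually_ne_zero.resolve_left fun h => ?_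
    have hzero : g = 0 := AnalyticOnNhd.eq_of_eventuallyEq
      (fun z _ => hgd.analyticAt z) (fun z _ => analyticAt_const) h
    simpa [hg] using congrFun hzero 0
  have hz₀ : ∀ᶠ z in 𝓝[≠] z₀, z ≠ 0 := by
    rcases eq_or_ne z₀ 0 with rfl | h
    · exact self_mem_nhdsWithin
    · exact nhdsWithin_le_nhds (eventually_ne_nhds h)
  filter_upwards [hg₀, hz₀] with z hgz hz h
  refine hgz ?_
  have hgZ : g z = z * regularizedZeta z := by
    rw [hg, regularizedZeta]
    field_simp
    ring
  rw [hgZ, h, mul_zero]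

lemma exists_norm_regularizedZeta_le {a b : ℝ} (ha : 0 < a) :
    ∃ C ≥ 0, ∀ z : ℂ, a ≤ z.re → z.re ≤ b → ‖regularizedZeta z‖ ≤ C * (1 + |z.im|) := by
  obtain ⟨C, hC⟩ := exists_norm_completedRiemannZeta₀_le a b
  refine ⟨(|b| + 1) * |C| + (|b| + 1) / a + 1, by positivity, fun z h₁ h₂ => ?_⟩
  have hb := abs_nonneg b
  have him := abs_nonneg z.im
  have hsub : ‖z - 1‖ ≤ (|b| + 1) * (1 + |z.im|) := by
    have hz := Complex.norm_le_abs_re_add_abs_im z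
    rw [abs_of_pos (by linarith)] at hz
    have := (norm_sub_le z 1).trans_eq (by rw [norm_one])
    nlinarith [le_abs_self b]
  have hΛ : ‖completedRiemannZeta₀ z‖ ≤ |C| := (hC z h₁ h₂).trans (le_abs_self C)
  have hz : a ≤ ‖z‖ := h₁.trans (Complex.re_le_norm z)
  calc ‖regularizedZeta z‖
      ≤ ‖z - 1‖ * ‖completedRiemannZeta₀ z‖ + ‖z - 1‖ / ‖z‖ + 1 := by
        refine (norm_add_le _ _).trans ?_
        rw [norm_one]
        gcongr
        exact (norm_sub_le _ _).trans_eq (by rw [norm_mul, norm_div])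
    _ ≤ (|b| + 1) * (1 + |z.im|) * |C| + (|b| + 1) * (1 + |z.im|) / a + 1 * (1 + |z.im|) := by
        gcongr
        linarith
    _ = _ := by ring

lemma exists_eventually_norm_regularizedZeta_add_le {z₀ : ℂ} (hz₀ : 0 < z₀.re) :
    ∃ C ≥ 0, ∀ᶠ z in 𝓝 z₀, ∀ t : ℝ,
      ‖regularizedZeta (z + t * Complex.I)‖ ≤ C * (1 + |t|) := by
  obtain ⟨C, hC₀, hC⟩ := exists_norm_regularizedZeta_le (b := z₀.re + 1) (half_pos hz₀)
  refine ⟨C * (2 + |z₀.im|), by positivity, ?_⟩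
  filter_upwards [Complex.continuous_re.continuousAt.eventually_mem
      (Icc_mem_nhds (half_lt_self hz₀) (lt_add_one z₀.re)),
    (continuous_abs.comp Complex.continuous_im).continuousAt.eventually_le_const
      (lt_add_one |z₀.im|)] with z hre him t
  have him' : |(z + t * Complex.I).im| ≤ |z₀.im| + 1 + |t| := by
    simpa using (abs_add_le z.im t).trans (by gcongr; exact him)
  calc ‖regularizedZeta (z + t * Complex.I)‖ ≤ C * (1 + |(z + t * Complex.I).im|) :=
        hC _ (by simpa using hre.1) (by simpa using hre.2)
    _ ≤ C * (1 + (|z₀.im| + 1 + |t|)) := by gcongr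
    _ ≤ C * ((2 + |z₀.im|) * (1 + |t|)) := by
        gcongr
        nlinarith [abs_nonneg t, abs_nonneg z₀.im]
    _ = C * (2 + |z₀.im|) * (1 + |t|) := by ring

lemma norm_Gamma_half_add_mul_I_sq (t : ℝ) :
    ‖Complex.Gamma (1 / 2 + t * Complex.I)‖ ^ 2 = Real.pi / Real.cosh (Real.pi * t) := by
  have h := Complex.Gamma_mul_Gamma_one_sub (1 / 2 + t * Complex.I)
  have hconj : 1 - (1 / 2 + t * Complex.I) = (starRingEnd ℂ) (1 / 2 + t * Complex.I) := by
    apply Complex.ext <;> norm_num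
  have hsin : Complex.sin (Real.pi * (1 / 2 + t * Complex.I)) =
      (Real.cosh (Real.pi * t) : ℝ) := by
    rw [show (Real.pi : ℂ) * (1 / 2 + t * Complex.I) =
      (Real.pi * t : ℝ) * Complex.I + Real.pi / 2 by push_cast; ring,
      Complex.sin_add_pi_div_two, Complex.cos_mul_I, Complex.ofReal_cosh]
  rw [hconj, Complex.Gamma_conj, Complex.mul_conj, Complex.normSq_eq_norm_sq, hsin] at h
  exact_mod_cast h

lemma norm_Gammaℝ_one_add_sq (t : ℝ) :
    ‖Complex.Gammaℝ (1 + 2 * (t * Complex.I))‖ ^ 2 = 1 / Real.cosh (Real.pi * t) := by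
  have hhalf : (1 + 2 * (t * Complex.I)) / 2 = 1 / 2 + t * Complex.I := by ring
  have hre : (-(1 + 2 * (t * Complex.I)) / 2).re = -(1 / 2) := by simp [neg_div]
  rw [Complex.Gammaℝ_def, norm_mul, mul_pow, hhalf, norm_Gamma_half_add_mul_I_sq,
    Complex.norm_cpow_eq_rpow_re_of_pos Real.pi_pos, hre, ← Real.rpow_mul_natCast Real.pi_pos.le,
    show -(1 / 2 : ℝ) * (2 : ℕ) = -1 by norm_num, Real.rpow_neg_one]
  field_simp

lemma exp_neg_le_norm_Gammaℝ_one_add (t : ℝ) :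
    Real.exp (-(Real.pi * |t| / 2)) ≤ ‖Complex.Gammaℝ (1 + 2 * (t * Complex.I))‖ := by
  have hcosh : Real.cosh (Real.pi * t) ≤ Real.exp (Real.pi * |t|) := by
    rw [← Real.cosh_abs, abs_mul, abs_of_pos Real.pi_pos, Real.cosh_eq]
    linarith [Real.exp_le_exp.mpr (show -(Real.pi * |t|) ≤ Real.pi * |t| by
      linarith [show 0 ≤ Real.pi * |t| by positivity])]
  refine le_of_sq_le_sq ?_ (norm_nonneg _)
  rw [norm_Gammaℝ_one_add_sq, ← Real.exp_nat_mul, Nat.cast_ofNat,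
    show 2 * -(Real.pi * |t| / 2) = -(Real.pi * |t|) by ring, Real.exp_neg, one_div]
  exact inv_anti₀ (Real.cosh_pos _) hcosh

theorem exists_le_norm_regularizedZeta_one_add :
    ∃ c > 0, ∀ t : ℝ, c ≤ (1 + |t|) ^ 3 * Real.exp (Real.pi * |t| / 2) *
      ‖regularizedZeta (1 + 2 * (t * Complex.I))‖ := by
  obtain ⟨c, hc, h⟩ := exists_le_norm_riemannZeta₁_one_add_I_mul
  refine ⟨c / 8, by positivity, fun t => ?_⟩
  have harg : 1 + Complex.I * (2 * t : ℝ) = 1 + 2 * (t * Complex.I) := by push_cast; ring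
  have hζ := h (2 * t)
  rw [harg, abs_mul, abs_two] at hζ
  rw [regularizedZeta_eq_Gammaℝ_mul (by simp), norm_mul]
  calc c / 8 ≤ (1 + 2 * |t|) ^ 3 * ‖riemannZeta₁ (1 + 2 * (t * Complex.I))‖ / 8 := by gcongr
    _ ≤ (2 * (1 + |t|)) ^ 3 * ‖riemannZeta₁ (1 + 2 * (t * Complex.I))‖ / 8 := by
        gcongr
        linarith
    _ = (1 + |t|) ^ 3 * Real.exp (Real.pi * |t| / 2) * (Real.exp (-(Real.pi * |t| / 2)) *
          ‖riemannZeta₁ (1 + 2 * (t * Complex.I))‖) := by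
        rw [Real.exp_neg]
        field_simp
        ring
    _ ≤ _ := by
        gcongr
        exact exp_neg_le_norm_Gammaℝ_one_add t

lemma sq_add_sq_eq_mul (p : ℂ) (t : ℝ) :
    p ^ 2 + (t : ℂ) ^ 2 = (p - t * Complex.I) * (p + t * Complex.I) := by
  linear_combination (t : ℂ) ^ 2 * Complex.I_sq

lemma sq_re_le_norm_sq_add_sq (p : ℂ) (t : ℝ) : p.re ^ 2 ≤ ‖p ^ 2 + (t : ℂ) ^ 2‖ := by
  rw [sq_add_sq_eq_mul, norm_mul, ← sq_abs, sq]
  gcongr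
  · simpa using Complex.abs_re_le_norm (p - t * Complex.I)
  · simpa using Complex.abs_re_le_norm (p + t * Complex.I)

lemma sq_add_sq_ne_zero {p : ℂ} (hp : p.re ≠ 0) (t : ℝ) : p ^ 2 + (t : ℂ) ^ 2 ≠ 0 :=
  norm_pos_iff.mp ((pow_pos (abs_pos.mpr hp) 2).trans_le
    ((sq_abs p.re).trans_le (sq_re_le_norm_sq_add_sq p t)))

lemma ae_sq_add_sq_ne_zero (p : ℂ) : ∀ᵐ t : ℝ, p ^ 2 + (t : ℂ) ^ 2 ≠ 0 := by
  have hpos : ∀ᵐ t : ℝ, t ≠ p.im := by simp [ae_iff]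
  have hneg : ∀ᵐ t : ℝ, t ≠ -p.im := by simp [ae_iff]
  filter_upwards [hpos, hneg] with t hpos hneg
  rw [sq_add_sq_eq_mul]
  refine mul_ne_zero (fun h => hpos ?_) fun h => hneg ?_
  · simpa [sub_eq_zero, eq_comm] using congrArg Complex.im h
  · simpa [eq_neg_iff_add_eq_zero, add_comm] using congrArg Complex.im h

lemma integrable_const_div_one_add_sq (C : ℝ) : Integrable fun t : ℝ => C / (1 + t ^ 2) := by
  simpa [div_eq_mul_inv] using integrable_inv_one_add_sq.const_mul C

section DivisionByZeros

variable {u : ℂ → ℂ} {s₀ a : ℂ} {r M : ℝ}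

lemma norm_le_of_div_sub_of_two_mul_le (hM : ∀ s ∈ Metric.ball s₀ r, ‖u s‖ ≤ M)
    (ha : 2 * r ≤ ‖a - s₀‖) {s : ℂ} (hs : s ∈ Metric.ball s₀ r) :
    ‖u s / (s - a)‖ ≤ 3 * M / (r + ‖a - s₀‖) := by
  have hr : 0 < r := Metric.pos_of_mem_ball hs
  have hsa : (r + ‖a - s₀‖) / 3 ≤ ‖s - a‖ := by
    have := norm_sub_norm_le (a - s₀) (s - s₀)
    rw [sub_sub_sub_cancel_right, norm_sub_rev a s] at this
    linarith [mem_ball_iff_norm.mp hs]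
  calc ‖u s / (s - a)‖ = ‖u s‖ / ‖s - a‖ := norm_div _ _
    _ ≤ M / ((r + ‖a - s₀‖) / 3) := by
        gcongr
        exacts [(norm_nonneg _).trans (hM s hs), hM s hs]
    _ = 3 * M / (r + ‖a - s₀‖) := by field_simp

lemma norm_dslope_le_of_lt_two_mul (hu : DifferentiableOn ℂ u (Metric.ball s₀ (4 * r)))
    (hM : ∀ s ∈ Metric.ball s₀ (4 * r), ‖u s‖ ≤ M) (hua : u a = 0)
    (ha : ‖a - s₀‖ < 2 * r) {s : ℂ} (hs : s ∈ Metric.ball s₀ r) :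
    ‖dslope u a s‖ ≤ 3 * M / (r + ‖a - s₀‖) := by
  have hr : 0 < r := Metric.pos_of_mem_ball hs
  have hcb : Metric.closedBall s₀ (3 * r) ⊆ Metric.ball s₀ (4 * r) :=
    Metric.closedBall_subset_ball (by linarith)
  have hd : DifferentiableOn ℂ (dslope u a) (Metric.ball s₀ (4 * r)) :=
    (Complex.differentiableOn_dslope (Metric.isOpen_ball.mem_nhds
      (mem_ball_iff_norm.mpr (by linarith)))).mpr hu
  refine Complex.norm_le_of_forall_mem_frontier_norm_le (U := Metric.ball s₀ (3 * r))
    Metric.isBounded_ball ((hd.mono hcb).diffContOnCl_ball subset_rfl) (fun z hz => ?_)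
    (subset_closure (Metric.ball_subset_ball (by linarith) hs))
  rw [frontier_ball _ (by positivity), mem_sphere_iff_norm] at hz
  have hza : (r + ‖a - s₀‖) / 3 ≤ ‖z - a‖ := by
    have := norm_sub_norm_le (z - s₀) (a - s₀)
    rw [sub_sub_sub_cancel_right] at this
    linarith
  have hne : z ≠ a := by
    rintro rfl
    linarith
  have hzM : ‖u z‖ ≤ M := hM z (hcb (mem_closedBall_iff_norm.mpr hz.le))
  calc ‖dslope u a z‖ = ‖u z‖ / ‖z - a‖ := by
        rw [dslope_of_ne _ hne, slope_def_field, hua, sub_zero, norm_div]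
    _ ≤ M / ((r + ‖a - s₀‖) / 3) := by
        gcongr
        exact (norm_nonneg _).trans hzM
    _ = 3 * M / (r + ‖a - s₀‖) := by field_simp

lemma exists_differentiableOn_div_sub (hr : 0 < r)
    (hu : DifferentiableOn ℂ u (Metric.ball s₀ (4 * r)))
    (hM : ∀ s ∈ Metric.ball s₀ (4 * r), ‖u s‖ ≤ M)
    (ha : a ∈ Metric.ball s₀ (4 * r) → u a = 0) :
    ∃ v : ℂ → ℂ, DifferentiableOn ℂ v (Metric.ball s₀ r) ∧
      (∀ s, s ≠ a → v s = u s / (s - a)) ∧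
      ∀ s ∈ Metric.ball s₀ r, ‖v s‖ ≤ 3 * M / (r + ‖a - s₀‖) := by
  have hsub : Metric.ball s₀ r ⊆ Metric.ball s₀ (4 * r) := Metric.ball_subset_ball (by linarith)
  rcases le_or_gt (2 * r) ‖a - s₀‖ with hfar | hnear
  · refine ⟨fun s => u s / (s - a), (hu.mono hsub).div (by fun_prop) fun s hs => ?_,
      fun s _ => rfl, fun s => norm_le_of_div_sub_of_two_mul_le (fun s hs => hM s (hsub hs)) hfar⟩
    rw [sub_ne_zero]
    rintro rfl
    linarith [mem_ball_iff_norm.mp hs]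
  · have haU : a ∈ Metric.ball s₀ (4 * r) := mem_ball_iff_norm.mpr (by linarith)
    refine ⟨dslope u a, ((Complex.differentiableOn_dslope (Metric.isOpen_ball.mem_nhds haU)).mpr
      hu).mono hsub, fun s hs => ?_, fun s => norm_dslope_le_of_lt_two_mul hu hM (ha haU) hnear⟩
    rw [dslope_of_ne _ hs, slope_def_field, ha haU, sub_zero]

lemma exists_differentiableOn_div_sub_mul_sub {b : ℂ} (hab : a ≠ b) (hr : 0 < r)
    (hu : DifferentiableOn ℂ u (Metric.ball s₀ (16 * r)))
    (hM : ∀ s ∈ Metric.ball s₀ (16 * r), ‖u s‖ ≤ M)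
    (ha : a ∈ Metric.ball s₀ (16 * r) → u a = 0) (hb : b ∈ Metric.ball s₀ (16 * r) → u b = 0) :
    ∃ v : ℂ → ℂ, DifferentiableOn ℂ v (Metric.ball s₀ r) ∧
      (∀ s, s ≠ a → s ≠ b → v s = u s / ((s - a) * (s - b))) ∧
      ∀ s ∈ Metric.ball s₀ r, ‖v s‖ ≤ 9 * M / ((r + ‖a - s₀‖) * (r + ‖b - s₀‖)) := by
  have hM0 : 0 ≤ M :=
    (norm_nonneg _).trans (hM s₀ (Metric.mem_ball_self (by positivity)))
  rw [show 16 * r = 4 * (4 * r) by ring] at hu hM ha hb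
  obtain ⟨v, hv, hv_eq, hv_le⟩ := exists_differentiableOn_div_sub (by positivity) hu hM ha
  obtain ⟨w, hw, hw_eq, hw_le⟩ := exists_differentiableOn_div_sub (a := b) hr hv hv_le fun h => by
    rw [hv_eq b hab.symm, hb (Metric.ball_subset_ball (by linarith) h), zero_div]
  refine ⟨w, hw, fun s hsa hsb => by rw [hw_eq s hsb, hv_eq s hsa, div_div],
    fun s hs => (hw_le s hs).trans ?_⟩
  calc 3 * (3 * M / (4 * r + ‖a - s₀‖)) / (r + ‖b - s₀‖)
      ≤ 3 * (3 * M / (r + ‖a - s₀‖)) / (r + ‖b - s₀‖) := by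
        gcongr
        linarith
    _ = 9 * M / ((r + ‖a - s₀‖) * (r + ‖b - s₀‖)) := by
        field_simp
        ring

end DivisionByZeros

lemma mul_one_add_abs_le_add_norm {r : ℝ} (hr : 0 < r) (c : ℂ) (t : ℝ) :
    r / (1 + ‖c‖ + r) * (1 + |t|) ≤ r + ‖c + t * Complex.I‖ := by
  have ht : |t| ≤ ‖c + t * Complex.I‖ + ‖c‖ := by
    simpa using norm_sub_le (c + t * Complex.I) c
  rw [div_mul_eq_mul_div, div_le_iff₀ (by positivity)]
  nlinarith [norm_nonneg c, norm_nonneg (c + t * Complex.I)]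

lemma mul_one_add_sq_le_add_norm_mul_add_norm {r : ℝ} (hr : 0 < r) (c : ℂ) (t : ℝ) :
    (r / (1 + ‖c‖ + r)) ^ 2 * (1 + t ^ 2) ≤
      (r + ‖c + t * Complex.I‖) * (r + ‖c - t * Complex.I‖) := by
  have hpos := mul_one_add_abs_le_add_norm hr c t
  have hneg := mul_one_add_abs_le_add_norm hr c (-t)
  rw [abs_neg, Complex.ofReal_neg, neg_mul, ← sub_eq_add_neg] at hneg
  calc (r / (1 + ‖c‖ + r)) ^ 2 * (1 + t ^ 2)
      ≤ (r / (1 + ‖c‖ + r)) ^ 2 * (1 + |t|) ^ 2 := by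
        gcongr
        nlinarith [sq_abs t, abs_nonneg t]
    _ = (r / (1 + ‖c‖ + r) * (1 + |t|)) * (r / (1 + ‖c‖ + r) * (1 + |t|)) := by ring
    _ ≤ _ := by gcongr

lemma exists_differentiableOn_div_sq_add_sq {u : ℂ → ℂ} {c s₀ : ℂ} {r M : ℝ} {t : ℝ} (hr : 0 < r)
    (hu : DifferentiableOn ℂ u (Metric.ball s₀ (16 * r)))
    (hM : ∀ s ∈ Metric.ball s₀ (16 * r), ‖u s‖ ≤ M)
    (hzero : ∀ s ∈ Metric.ball s₀ (16 * r), (s - c) ^ 2 + (t : ℂ) ^ 2 = 0 → u s = 0)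
    (ht : t ≠ 0) :
    ∃ v : ℂ → ℂ, DifferentiableOn ℂ v (Metric.ball s₀ r) ∧
      (∀ s, (s - c) ^ 2 + (t : ℂ) ^ 2 ≠ 0 → v s = u s / ((s - c) ^ 2 + (t : ℂ) ^ 2)) ∧
      ∀ s ∈ Metric.ball s₀ r,
        ‖v s‖ ≤ 9 * M / (r / (1 + ‖c - s₀‖ + r)) ^ 2 / (1 + t ^ 2) := by
  have hfactor (s : ℂ) : (s - c) ^ 2 + (t : ℂ) ^ 2 =
      (s - (c + t * Complex.I)) * (s - (c - t * Complex.I)) := by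
    rw [sq_add_sq_eq_mul]
    ring
  have hM0 : 0 ≤ M := (norm_nonneg _).trans (hM s₀ (Metric.mem_ball_self (by positivity)))
  have hne : c + t * Complex.I ≠ c - t * Complex.I := by
    rw [sub_eq_add_neg, Ne, add_right_inj, self_eq_neg]
    simpa using ht
  obtain ⟨v, hv, hv_eq, hv_le⟩ := exists_differentiableOn_div_sub_mul_sub hne hr hu hM
    (fun h => hzero _ h (by rw [hfactor]; ring)) (fun h => hzero _ h (by rw [hfactor]; ring))
  refine ⟨v, hv, fun s hs => ?_, fun s hs => (hv_le s hs).trans ?_⟩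
  · rw [hfactor] at hs ⊢
    exact hv_eq s (sub_ne_zero.mp (left_ne_zero_of_mul hs))
      (sub_ne_zero.mp (right_ne_zero_of_mul hs))
  · rw [div_div, add_sub_right_comm, sub_right_comm]
    exact div_le_div_of_nonneg_left (by positivity) (by positivity)
      (mul_one_add_sq_le_add_norm_mul_add_norm hr _ t)

theorem analyticAt_integral_div_sq_add_sq {u : ℂ → ℝ → ℂ} {c s₀ : ℂ} {U : Set ℂ} {M : ℝ}
    (hU : U ∈ 𝓝 s₀) (hmeas : ∀ s ∈ U, AEStronglyMeasurable (u s))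
    (hd : ∀ t, DifferentiableOn ℂ (fun s => u s t) U) (hM : ∀ s ∈ U, ∀ t, ‖u s t‖ ≤ M)
    (hzero : ∀ s ∈ U, ∀ t : ℝ, (s - c) ^ 2 + (t : ℂ) ^ 2 = 0 → u s t = 0) :
    AnalyticAt ℂ (fun s => ∫ t : ℝ, u s t / ((s - c) ^ 2 + (t : ℂ) ^ 2)) s₀ := by
  obtain ⟨R, hR, hRU⟩ := Metric.mem_nhds_iff.mp hU
  obtain ⟨r, rfl⟩ : ∃ r, R = 16 * r := ⟨R / 16, by ring⟩
  have hr : 0 < r := by linarith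
  have hrU : Metric.ball s₀ r ⊆ U := (Metric.ball_subset_ball (by linarith)).trans hRU
  choose! v hv hv_eq hv_le using fun (t : ℝ) (ht : t ≠ 0) =>
    exists_differentiableOn_div_sq_add_sq (c := c) hr ((hd t).mono hRU)
      (fun s hs => hM s (hRU hs) t) (fun s hs => hzero s (hRU hs) t) ht
  have hne : ∀ᵐ t : ℝ, t ≠ 0 := by simp [ae_iff]
  have hae (s : ℂ) : (fun t => u s t / ((s - c) ^ 2 + (t : ℂ) ^ 2)) =ᵐ[volume] fun t => v t s := by
    filter_upwards [hne, ae_sq_add_sq_ne_zero (s - c)] with t ht hst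
    exact (hv_eq t ht s hst).symm
  simp_rw [fun s => integral_congr_ae (hae s)]
  refine analyticAt_integral_of_dominated (g := fun s t => v t s) (Metric.ball_mem_nhds s₀ hr)
    (fun s hs => .congr (.div₀ (hmeas s (hrU hs)) (by fun_prop)) (hae s)) ?_ ?_
    (integrable_const_div_one_add_sq (9 * M / (r / (1 + ‖c - s₀‖ + r)) ^ 2))
  · filter_upwards [hne] with t ht using hv t ht
  · filter_upwards [hne] with t ht s hs using hv_le t ht s hs

lemma analyticAt_integral_inv_sq_add_sq {p : ℂ} (hp : p.re ≠ 0) :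
    AnalyticAt ℂ (fun p : ℂ => ∫ t : ℝ, (p ^ 2 + (t : ℂ) ^ 2)⁻¹) p := by
  have hU : {q : ℂ | q.re ≠ 0} ∈ 𝓝 p :=
    (isOpen_ne_fun Complex.continuous_re continuous_const).mem_nhds hp
  simpa only [sub_zero, one_div] using analyticAt_integral_div_sq_add_sq (u := fun _ _ => 1)
    (c := 0) (M := 1) hU (fun _ _ => aestronglyMeasurable_const)
    (fun _ => differentiableOn_const _) (fun _ _ _ => norm_one.le)
    (fun s hs t h => absurd h (sq_add_sq_ne_zero (by simpa using hs) t))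

lemma integral_univ_inv_sq_add_sq_ofReal {x : ℝ} (hx : 0 < x) :
    ∫ t : ℝ, ((x : ℂ) ^ 2 + (t : ℂ) ^ 2)⁻¹ = Real.pi / x := by
  have hscale (t : ℝ) : (x ^ 2 + t ^ 2)⁻¹ = (x ^ 2)⁻¹ * (1 + (x⁻¹ * t) ^ 2)⁻¹ := by
    field_simp
  have hreal : ∫ t : ℝ, (x ^ 2 + t ^ 2)⁻¹ = Real.pi / x := by
    simp_rw [hscale]
    rw [integral_const_mul, Measure.integral_comp_mul_left (fun t : ℝ => (1 + t ^ 2)⁻¹),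
      integral_univ_inv_one_add_sq, inv_inv, abs_of_pos hx, smul_eq_mul]
    field_simp
  exact_mod_cast (integral_ofReal (𝕜 := ℂ)).trans (congrArg _ hreal)

theorem integral_univ_inv_sq_add_sq {p : ℂ} (hp : 0 < p.re) :
    ∫ t : ℝ, (p ^ 2 + (t : ℂ) ^ 2)⁻¹ = Real.pi / p := by
  have hlhs : AnalyticOnNhd ℂ (fun p : ℂ => ∫ t : ℝ, (p ^ 2 + (t : ℂ) ^ 2)⁻¹)
      {p | 0 < p.re} := fun q hq => analyticAt_integral_inv_sq_add_sq (ne_of_gt hq)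
  have hrhs : AnalyticOnNhd ℂ (fun p : ℂ => (Real.pi : ℂ) / p) {p | 0 < p.re} := fun q hq =>
    analyticAt_const.div analyticAt_id (by rintro rfl; simp at hq)
  have hreal : Tendsto (fun x : ℝ => (x : ℂ)) (𝓝[≠] 1) (𝓝[≠] 1) := by
    simpa using (hasDerivAt_id (1 : ℝ)).ofReal_comp.tendsto_nhdsNE
  have hfreq : ∃ᶠ z in 𝓝[≠] (1 : ℂ), (∫ t : ℝ, (z ^ 2 + (t : ℂ) ^ 2)⁻¹) = Real.pi / z := by
    refine hreal.frequently (Eventually.frequently ?_)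
    filter_upwards [nhdsWithin_le_nhds (lt_mem_nhds zero_lt_one)] with x hx
      using integral_univ_inv_sq_add_sq_ofReal hx
  exact hlhs.eqOn_of_preconnected_of_frequently_eq hrhs
    (convex_halfSpace_re_gt 0).isPreconnected (by simp) hfreq hp

lemma integral_univ_inv_sq_add_sq_of_neg {p : ℂ} (hp : p.re < 0) :
    ∫ t : ℝ, (p ^ 2 + (t : ℂ) ^ 2)⁻¹ = -(Real.pi / p) := by
  rw [← neg_sq p, integral_univ_inv_sq_add_sq (by simpa using hp), div_neg]

lemma integrable_inv_sq_add_sq {p : ℂ} (hp : p.re ≠ 0) :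
    Integrable fun t : ℝ => (p ^ 2 + (t : ℂ) ^ 2)⁻¹ := by
  have hp0 : (Real.pi : ℂ) / p ≠ 0 :=
    div_ne_zero (by exact_mod_cast Real.pi_ne_zero) (by rintro rfl; simp at hp)
  refine .of_integral_ne_zero ?_
  rcases hp.lt_or_gt with h | h
  · rwa [integral_univ_inv_sq_add_sq_of_neg h, neg_ne_zero]
  · rwa [integral_univ_inv_sq_add_sq h]

/-- The quotient `H μ / (Λ(1 + 2μ) Λ(1 - 2μ))`, with its removable singularity at `μ = 0`
removed. -/
noncomputable def spectralWeight (H : ℂ → ℂ) (μ : ℂ) : ℂ :=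
  -4 * μ ^ 2 * H μ / (regularizedZeta (1 + 2 * μ) * regularizedZeta (1 - 2 * μ))

lemma spectralWeight_of_ne_zero (H : ℂ → ℂ) {μ : ℂ} (hμ : μ ≠ 0) :
    spectralWeight H μ =
      H μ / (completedRiemannZeta (1 + 2 * μ) * completedRiemannZeta (1 - 2 * μ)) := by
  rw [spectralWeight, regularizedZeta_of_ne_one (by simpa using hμ),
    regularizedZeta_of_ne_one (by simpa using hμ),
    ← mul_div_mul_left (H μ) _ (mul_ne_zero (by norm_num : (-4 : ℂ) ≠ 0) (pow_ne_zero 2 hμ))]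
  congr 1
  ring

lemma one_add_abs_pow_mul_exp_neg_le (n : ℕ) (t : ℝ) :
    (1 + |t|) ^ n * Real.exp (-(Real.pi * |t|)) ≤ n.factorial * Real.exp 1 := by
  have hpow := Real.pow_div_factorial_le_exp (1 + |t|) (by positivity) n
  rw [div_le_iff₀ (by positivity)] at hpow
  calc (1 + |t|) ^ n * Real.exp (-(Real.pi * |t|))
      ≤ Real.exp (1 + |t|) * n.factorial * Real.exp (-(Real.pi * |t|)) := by gcongr
    _ = n.factorial * Real.exp (1 + |t| - Real.pi * |t|) := by
        rw [sub_eq_add_neg (1 + |t|), Real.exp_add (1 + |t|)]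
        ring
    _ ≤ n.factorial * Real.exp 1 := by
        gcongr
        nlinarith [abs_nonneg t, Real.pi_gt_three]

lemma exists_le_norm_regularizedZeta_mul :
    ∃ c > 0, ∀ t : ℝ, c ≤ (1 + |t|) ^ 6 * Real.exp (Real.pi * |t|) *
      ‖regularizedZeta (1 + 2 * (t * Complex.I)) * regularizedZeta (1 - 2 * (t * Complex.I))‖ := by
  obtain ⟨c, hc, hZ⟩ := exists_le_norm_regularizedZeta_one_add
  refine ⟨c * c, by positivity, fun t => ?_⟩
  have hadd := hZ t
  have hsub := hZ (-t)
  rw [abs_neg, Complex.ofReal_neg, neg_mul, mul_neg, ← sub_eq_add_neg] at hsub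
  have hexp : Real.exp (Real.pi * |t|) =
      Real.exp (Real.pi * |t| / 2) * Real.exp (Real.pi * |t| / 2) := by
    rw [← Real.exp_add, add_halves]
  rw [hexp, norm_mul]
  exact (mul_le_mul hadd hsub hc.le (by positivity)).trans_eq (by ring)

lemma meromorphicAt_regularizedZeta_comp {f : ℂ → ℂ} {z : ℂ} (hf : AnalyticAt ℂ f z) :
    MeromorphicAt (fun z => regularizedZeta (f z)) z :=
  (meromorphicAt_regularizedZeta _).comp_analyticAt hf

namespace IsTestFunction

variable {η : ℝ} {H : ℂ → ℂ}

lemma analyticAt (hH : IsTestFunction η H) {μ : ℂ} (hμ : |μ.re| < 2 * η) : AnalyticAt ℂ H μ :=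
  hH.holomorphic.analyticAt ((isOpen_lt (by fun_prop) continuous_const).mem_nhds hμ)

lemma spectralWeight_neg (hH : IsTestFunction η H) {μ : ℂ} (hμ : |μ.re| < 2 * η) :
    spectralWeight H (-μ) = spectralWeight H μ := by
  rw [spectralWeight, spectralWeight, hH.even μ hμ, neg_sq, mul_neg, ← sub_eq_add_neg,
    sub_neg_eq_add, mul_comm (regularizedZeta (1 - 2 * μ))]

lemma analyticAt_spectralWeight (hH : IsTestFunction η H) (hη : 0 < η) {μ : ℂ} (hμ : μ.re = 0) :
    AnalyticAt ℂ (spectralWeight H) μ := by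
  have hHμ := hH.analyticAt (μ := μ) (by simpa [hμ] using hη)
  have hadd : (1 + 2 * μ).re = 1 := by simp [hμ]
  have hsub : (1 - 2 * μ).re = 1 := by simp [hμ]
  have hZadd : AnalyticAt ℂ (fun μ => regularizedZeta (1 + 2 * μ)) μ :=
    (analyticAt_regularizedZeta fun h => by simp [h] at hadd).fun_comp
      (f := fun μ => 1 + 2 * μ) (by fun_prop)
  have hZsub : AnalyticAt ℂ (fun μ => regularizedZeta (1 - 2 * μ)) μ :=
    (analyticAt_regularizedZeta fun h => by simp [h] at hsub).fun_comp
      (f := fun μ => 1 - 2 * μ) (by fun_prop)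
  exact AnalyticAt.div (by fun_prop) (hZadd.mul hZsub)
    (mul_ne_zero (regularizedZeta_ne_zero hadd.ge) (regularizedZeta_ne_zero hsub.ge))

lemma meromorphicAt_spectralWeight (hH : IsTestFunction η H) {μ : ℂ} (hμ : |μ.re| < 2 * η) :
    MeromorphicAt (spectralWeight H) μ := by
  have hnum : AnalyticAt ℂ (fun μ => -4 * μ ^ 2 * H μ) μ :=
    AnalyticAt.mul (by fun_prop) (hH.analyticAt hμ)
  exact hnum.meromorphicAt.div ((meromorphicAt_regularizedZeta_comp (by fun_prop)).mul
    (meromorphicAt_regularizedZeta_comp (by fun_prop)))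

lemma exists_norm_spectralWeight_le (hH : IsTestFunction η H) (hη : 0 < η) :
    ∃ C ≥ 0, ∀ t : ℝ,
      ‖spectralWeight H (t * Complex.I)‖ ≤ C * ((1 + |t|) ^ 8 * Real.exp (-(Real.pi * |t|))) := by
  obtain ⟨c, hc, hZ⟩ := exists_le_norm_regularizedZeta_mul
  obtain ⟨B, hB⟩ := hH.decay
  have hB0 : 0 ≤ B := by simpa using (norm_nonneg _).trans (hB 0 (by simpa using hη))
  refine ⟨4 * B / c, by positivity, fun t => ?_⟩
  have hHt : ‖H (t * Complex.I)‖ ≤ B * Real.exp (-(2 * Real.pi * |t|)) := by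
    simpa using hB (t * Complex.I) (by simpa using hη)
  have hsq : ‖(t : ℂ) * Complex.I‖ ^ 2 ≤ (1 + |t|) ^ 2 := by
    gcongr
    simp
  have hden : c / ((1 + |t|) ^ 6 * Real.exp (Real.pi * |t|)) ≤
      ‖regularizedZeta (1 + 2 * (t * Complex.I)) * regularizedZeta (1 - 2 * (t * Complex.I))‖ := by
    rw [div_le_iff₀' (by positivity)]
    exact hZ t
  calc ‖spectralWeight H (t * Complex.I)‖
      ≤ 4 * (1 + |t|) ^ 2 * (B * Real.exp (-(2 * Real.pi * |t|))) /
          (c / ((1 + |t|) ^ 6 * Real.exp (Real.pi * |t|))) := by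
        rw [spectralWeight, norm_div, norm_mul, norm_mul, norm_pow, norm_neg, Complex.norm_ofNat]
        gcongr
    _ = 4 * B / c * ((1 + |t|) ^ 8 * Real.exp (-(Real.pi * |t|))) := by
        rw [show -(2 * Real.pi * |t|) = -(Real.pi * |t|) + -(Real.pi * |t|) by ring,
          Real.exp_add, Real.exp_neg]
        field_simp

lemma exists_norm_spectralWeight_mul_pow_le (hH : IsTestFunction η H) (hη : 0 < η) (n : ℕ) :
    ∃ C, ∀ t : ℝ, ‖spectralWeight H (t * Complex.I)‖ * (1 + |t|) ^ n ≤ C := by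
  obtain ⟨C, hC, hw⟩ := hH.exists_norm_spectralWeight_le hη
  refine ⟨C * ((n + 8).factorial * Real.exp 1), fun t => ?_⟩
  calc ‖spectralWeight H (t * Complex.I)‖ * (1 + |t|) ^ n
      ≤ C * ((1 + |t|) ^ 8 * Real.exp (-(Real.pi * |t|))) * (1 + |t|) ^ n := by
        gcongr
        exact hw t
    _ = C * ((1 + |t|) ^ (n + 8) * Real.exp (-(Real.pi * |t|))) := by ring
    _ ≤ _ := mul_le_mul_of_nonneg_left (one_add_abs_pow_mul_exp_neg_le _ t) hC

end IsTestFunction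

section Kernel

variable {ι : Type*} [Fintype ι]

/-- The integrand of the continuous spectrum, for an arbitrary finite family of parameters, with
its poles at `μ = ±(s - 1 - α i)` and at `μ = 0` removed. -/
noncomputable def regularKernel (α : ι → ℂ) (H : ℂ → ℂ) (s μ : ℂ) : ℂ :=
  spectralWeight H μ * ∏ j, regularizedZeta (s + μ - α j) * regularizedZeta (s - μ - α j)

variable {η : ℝ} {α : ι → ℂ} {H : ℂ → ℂ} {s s₀ : ℂ}

lemma regularKernel_neg (hH : IsTestFunction η H) {μ : ℂ} (hμ : |μ.re| < 2 * η) :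
    regularKernel α H s (-μ) = regularKernel α H s μ := by
  simp only [regularKernel, hH.spectralWeight_neg hμ, ← sub_eq_add_neg, sub_neg_eq_add, mul_comm]

lemma analyticAt_regularKernel (hH : IsTestFunction η H) (hη : 0 < η) {f g : ℂ → ℂ} {z : ℂ}
    (hf : AnalyticAt ℂ f z) (hg : AnalyticAt ℂ g z) (hgz : (g z).re = 0)
    (hfz : ∀ j, 0 < (f z - α j).re) : AnalyticAt ℂ (fun z => regularKernel α H (f z) (g z)) z := by
  have hZ (j : ι) (h : ℂ → ℂ) (hh : AnalyticAt ℂ h z) (hre : (h z).re = (f z - α j).re) :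
      AnalyticAt ℂ (fun z => regularizedZeta (h z)) z :=
    (analyticAt_regularizedZeta fun h0 => (hfz j).ne' (by rw [← hre, h0, Complex.zero_re])).fun_comp
      hh
  refine ((hH.analyticAt_spectralWeight hη hgz).fun_comp hg).mul
    (Finset.analyticAt_fun_prod _ fun j _ => (hZ j _ (by fun_prop) ?_).mul
      (hZ j _ (by fun_prop) ?_)) <;> simp [hgz]

lemma meromorphicAt_regularKernel (hH : IsTestFunction η H) {f g : ℂ → ℂ} {z : ℂ}
    (hf : AnalyticAt ℂ f z) (hg : AnalyticAt ℂ g z) (hgz : |(g z).re| < 2 * η) :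
    MeromorphicAt (fun z => regularKernel α H (f z) (g z)) z :=
  ((hH.meromorphicAt_spectralWeight hgz).comp_analyticAt hg).mul
    (.fun_prod fun _ _ => (meromorphicAt_regularizedZeta_comp (by fun_prop)).mul
      (meromorphicAt_regularizedZeta_comp (by fun_prop)))

lemma continuous_regularKernel (hH : IsTestFunction η H) (hη : 0 < η)
    (hs : ∀ j, 0 < (s - α j).re) :
    Continuous fun t : ℝ => regularKernel α H s (t * Complex.I) :=
  continuous_iff_continuousAt.mpr fun t =>
    (analyticAt_regularKernel hH hη (f := fun _ => s) (g := fun z : ℂ => z * Complex.I)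
      (by fun_prop) (by fun_prop) (by simp) hs).continuousAt.comp
      (f := fun t : ℝ => (t : ℂ)) (by fun_prop)

lemma exists_eventually_norm_regularizedZeta_mul_le {a : ℂ} (hs₀ : 0 < (s₀ - a).re) :
    ∃ C ≥ 0, ∀ᶠ s in 𝓝 s₀, ∀ t : ℝ,
      ‖regularizedZeta (s + t * Complex.I - a) * regularizedZeta (s - t * Complex.I - a)‖ ≤
        C * (1 + |t|) ^ 2 := by
  obtain ⟨C, hC, hbound⟩ := exists_eventually_norm_regularizedZeta_add_le hs₀
  refine ⟨C ^ 2, by positivity, ?_⟩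
  have hcont : Tendsto (fun s : ℂ => s - a) (𝓝 s₀) (𝓝 (s₀ - a)) :=
    (continuous_sub_right a).continuousAt
  filter_upwards [hcont.eventually hbound] with s hs t
  have hadd := hs t
  have hsub := hs (-t)
  rw [abs_neg, Complex.ofReal_neg, neg_mul, ← sub_eq_add_neg, sub_right_comm] at hsub
  rw [sub_add_eq_add_sub] at hadd
  rw [norm_mul, ← mul_pow, sq]
  gcongr

lemma exists_eventually_norm_regularKernel_le (hH : IsTestFunction η H) (hη : 0 < η)
    (hs₀ : ∀ j, 0 < (s₀ - α j).re) :
    ∃ M, ∀ᶠ s in 𝓝 s₀, ∀ t : ℝ, ‖regularKernel α H s (t * Complex.I)‖ ≤ M / (1 + t ^ 2) := by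
  choose C hC hZ using fun j => exists_eventually_norm_regularizedZeta_mul_le (hs₀ j)
  obtain ⟨W, hW⟩ := hH.exists_norm_spectralWeight_mul_pow_le hη (2 * Fintype.card ι + 2)
  refine ⟨W * ∏ j, C j, ?_⟩
  filter_upwards [eventually_all.mpr hZ] with s hs t
  rw [le_div_iff₀ (by positivity), regularKernel, norm_mul, norm_prod]
  calc ‖spectralWeight H (t * Complex.I)‖ * (∏ j, _) * (1 + t ^ 2)
      ≤ ‖spectralWeight H (t * Complex.I)‖ * (∏ j, C j * (1 + |t|) ^ 2) * (1 + |t|) ^ 2 := by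
        gcongr ?_ * (∏ j, ?_) * ?_ with j
        · exact mul_nonneg (norm_nonneg _) (Finset.prod_nonneg fun j _ =>
            mul_nonneg (hC j) (by positivity))
        · exact hs j t
        · nlinarith [sq_abs t, abs_nonneg t]
    _ = ‖spectralWeight H (t * Complex.I)‖ * (1 + |t|) ^ (2 * Fintype.card ι + 2) * ∏ j, C j := by
        rw [Finset.prod_mul_distrib, Finset.prod_const, Finset.card_univ, pow_add, pow_mul]
        ring
    _ ≤ W * ∏ j, C j := by
        gcongr
        exacts [Finset.prod_nonneg fun j _ => hC j, hW t]

/-- The integral along `Re μ = 0` of `regularKernel` with the poles `μ = ±(s - 1 - α i)` restored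
for `i ∈ S`. -/
noncomputable def polarIntegral (α : ι → ℂ) (H : ℂ → ℂ) (S : Finset ι) (s : ℂ) : ℂ :=
  ∫ t : ℝ, regularKernel α H s (t * Complex.I) *
    ∏ i ∈ S, ((s - (1 + α i)) ^ 2 + (t : ℂ) ^ 2)⁻¹

omit [Fintype ι] in
lemma eventually_re_sub_ne_zero {S : Finset ι} (hS : ∀ i ∈ S, (s₀ - (1 + α i)).re ≠ 0) :
    ∀ᶠ s in 𝓝 s₀, ∀ i ∈ S, (s - (1 + α i)).re ≠ 0 :=
  (Finset.eventually_all S).mpr fun i hi =>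
    (isOpen_ne_fun (by fun_prop) continuous_const).mem_nhds (hS i hi)

lemma exists_eventually_norm_polar_integrand_le (hH : IsTestFunction η H) (hη : 0 < η)
    {S : Finset ι} (hs₀ : ∀ j, 0 < (s₀ - α j).re) (hS : ∀ i ∈ S, (s₀ - (1 + α i)).re ≠ 0) :
    ∃ M, ∀ᶠ s in 𝓝 s₀, ∀ t : ℝ, ‖regularKernel α H s (t * Complex.I) *
      ∏ i ∈ S, ((s - (1 + α i)) ^ 2 + (t : ℂ) ^ 2)⁻¹‖ ≤ M / (1 + t ^ 2) := by
  obtain ⟨M, hM⟩ := exists_eventually_norm_regularKernel_le hH hη hs₀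
  set B : ℂ → ℝ := fun s => ∏ i ∈ S, ((s - (1 + α i)).re ^ 2)⁻¹
  have hB : ContinuousAt B s₀ := tendsto_finsetProd _ fun i hi =>
    ContinuousAt.inv₀ (by fun_prop) (pow_ne_zero 2 (hS i hi))
  refine ⟨M * (B s₀ + 1), ?_⟩
  filter_upwards [hM, eventually_re_sub_ne_zero hS, hB.eventually_le_const (lt_add_one _)]
    with s hK hne hBs t
  calc ‖regularKernel α H s (t * Complex.I) * ∏ i ∈ S, ((s - (1 + α i)) ^ 2 + (t : ℂ) ^ 2)⁻¹‖
      ≤ M / (1 + t ^ 2) * B s := by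
        rw [norm_mul, norm_prod]
        refine mul_le_mul (hK t) (Finset.prod_le_prod (fun _ _ => norm_nonneg _) fun i hi => ?_)
          (by positivity) ((norm_nonneg _).trans (hK t))
        rw [norm_inv]
        exact inv_anti₀ (by have := hne i hi; positivity) (sq_re_le_norm_sq_add_sq _ t)
    _ ≤ M / (1 + t ^ 2) * (B s₀ + 1) := by
        gcongr
        exact (norm_nonneg _).trans (hK t)
    _ = _ := by ring

lemma continuous_polar_integrand (hH : IsTestFunction η H) (hη : 0 < η) {S : Finset ι}
    (hs : ∀ j, 0 < (s - α j).re) (hS : ∀ i ∈ S, (s - (1 + α i)).re ≠ 0) :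
    Continuous fun t : ℝ => regularKernel α H s (t * Complex.I) *
      ∏ i ∈ S, ((s - (1 + α i)) ^ 2 + (t : ℂ) ^ 2)⁻¹ :=
  (continuous_regularKernel hH hη hs).mul (continuous_finsetProd _ fun i hi =>
    Continuous.inv₀ (by fun_prop) (sq_add_sq_ne_zero (hS i hi)))

lemma integrable_polar_integrand (hH : IsTestFunction η H) (hη : 0 < η) {S : Finset ι}
    (hs : ∀ j, 0 < (s - α j).re) (hS : ∀ i ∈ S, (s - (1 + α i)).re ≠ 0) :
    Integrable fun t : ℝ => regularKernel α H s (t * Complex.I) *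
      ∏ i ∈ S, ((s - (1 + α i)) ^ 2 + (t : ℂ) ^ 2)⁻¹ := by
  obtain ⟨M, hM⟩ := exists_eventually_norm_polar_integrand_le hH hη hs hS
  exact (integrable_const_div_one_add_sq M).mono'
    (continuous_polar_integrand hH hη hs hS).aestronglyMeasurable (.of_forall hM.self_of_nhds)

omit [Fintype ι] in
lemma eventually_re_sub_pos [Finite ι] (hs₀ : ∀ j, 0 < (s₀ - α j).re) :
    ∀ᶠ s in 𝓝 s₀, ∀ j, 0 < (s - α j).re :=
  eventually_all.mpr fun j =>
    (isOpen_lt continuous_const (by fun_prop)).mem_nhds (hs₀ j)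

theorem analyticAt_polarIntegral (hH : IsTestFunction η H) (hη : 0 < η) {S : Finset ι}
    (hs₀ : ∀ j, 0 < (s₀ - α j).re) (hS : ∀ i ∈ S, (s₀ - (1 + α i)).re ≠ 0) :
    AnalyticAt ℂ (polarIntegral α H S) s₀ := by
  obtain ⟨M, hM⟩ := exists_eventually_norm_polar_integrand_le hH hη hs₀ hS
  refine analyticAt_integral_of_dominated (hM.and ((eventually_re_sub_pos hs₀).and
    (eventually_re_sub_ne_zero hS)))
    (fun s hs => (continuous_polar_integrand hH hη hs.2.1 hs.2.2).aestronglyMeasurable)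
    (.of_forall fun t s hs => ?_) (.of_forall fun t s hs => hs.1 t)
    (integrable_const_div_one_add_sq M)
  refine ((analyticAt_regularKernel hH hη analyticAt_id analyticAt_const (by simp) hs.2.1).mul
    (Finset.analyticAt_fun_prod _ fun i hi => AnalyticAt.inv (by fun_prop)
      (sq_add_sq_ne_zero (hs.2.2 i hi) t))).differentiableAt.differentiableWithinAt

/-- The integral of `regularKernel` with the pair of poles `μ = ±(s - 1 - α i)` restored and the
value of the kernel there subtracted, so that the line of integration can be crossed. -/
noncomputable def regularPolarIntegral (α : ι → ℂ) (H : ℂ → ℂ) (i : ι) (s : ℂ) : ℂ :=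
  ∫ t : ℝ, (regularKernel α H s (t * Complex.I) - regularKernel α H s (s - (1 + α i))) /
    ((s - (1 + α i)) ^ 2 + (t : ℂ) ^ 2)

lemma regularPolarIntegral_eq_sub (hH : IsTestFunction η H) (hη : 0 < η)
    (hs : ∀ j, 0 < (s - α j).re) {i : ι} (hi : (s - (1 + α i)).re ≠ 0) :
    regularPolarIntegral α H i s = polarIntegral α H {i} s -
      regularKernel α H s (s - (1 + α i)) * ∫ t : ℝ, ((s - (1 + α i)) ^ 2 + (t : ℂ) ^ 2)⁻¹ := by
  have hint := integrable_polar_integrand hH hη hs (S := {i}) (by simpa using hi)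
  rw [polarIntegral, ← integral_const_mul,
    ← integral_sub hint ((integrable_inv_sq_add_sq hi).const_mul _), regularPolarIntegral]
  simp only [div_eq_mul_inv, sub_mul, Finset.prod_singleton]

theorem analyticAt_regularPolarIntegral (hH : IsTestFunction η H) (hη : 0 < η)
    (hs₀ : ∀ j, 0 < (s₀ - α j).re) {i : ι} (hi : (s₀ - (1 + α i)).re = 0) :
    AnalyticAt ℂ (regularPolarIntegral α H i) s₀ := by
  obtain ⟨M, hM⟩ := exists_eventually_norm_regularKernel_le hH hη hs₀
  have hψ : AnalyticAt ℂ (fun s => regularKernel α H s (s - (1 + α i))) s₀ :=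
    analyticAt_regularKernel hH hη (by fun_prop) (by fun_prop) hi hs₀
  set B := ‖regularKernel α H s₀ (s₀ - (1 + α i))‖ + 1
  refine analyticAt_integral_div_sq_add_sq (M := M + B)
    (u := fun s t => regularKernel α H s (t * Complex.I) - regularKernel α H s (s - (1 + α i)))
    (hM.and ((eventually_re_sub_pos hs₀).and (hψ.eventually_analyticAt.and
      (hψ.continuousAt.norm.eventually_le_const (lt_add_one _)))))
    (fun s hs => ((continuous_regularKernel hH hη hs.2.1).sub
      continuous_const).aestronglyMeasurable) (fun t s hs => ?_) (fun s hs t => ?_)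
    fun s _ t hst => ?_
  · exact ((analyticAt_regularKernel hH hη analyticAt_id analyticAt_const (by simp)
      hs.2.1).sub hs.2.2.1).differentiableAt.differentiableWithinAt
  · have hM0 : 0 ≤ M := by simpa using (norm_nonneg _).trans (hs.1 0)
    exact (norm_sub_le _ _).trans (add_le_add ((hs.1 t).trans
      (div_le_self hM0 (le_add_of_nonneg_right (sq_nonneg t)))) hs.2.2.2)
  · rw [sq_add_sq_eq_mul, mul_eq_zero, sub_eq_zero, add_eq_zero_iff_eq_neg] at hst
    rcases hst with hst | hst <;> rw [hst]
    · exact sub_self _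
    · rw [regularKernel_neg hH (by simpa using hη), sub_self]

end Kernel

lemma re_sub_one_add (s a : ℂ) : (s - (1 + a)).re = (s - a).re - 1 := by
  simp [sub_sub, add_comm]

lemma contIntegrand_eq_regularKernel_mul {α : Fin 3 → ℂ} {s : ℂ}
    (hs : ∀ i, (s - (1 + α i)).re ≠ 0) (H : ℂ → ℂ) {t : ℝ} (ht : t ≠ 0) :
    contIntegrand α H s (t * Complex.I) = regularKernel α H s (t * Complex.I) *
      ∏ i, ((s - (1 + α i)) ^ 2 + (t : ℂ) ^ 2)⁻¹ := by
  have hΛ (i : Fin 3) : completedRiemannZeta (s + t * Complex.I - α i) *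
      completedRiemannZeta (s - t * Complex.I - α i) =
        regularizedZeta (s + t * Complex.I - α i) * regularizedZeta (s - t * Complex.I - α i) *
          ((s - (1 + α i)) ^ 2 + (t : ℂ) ^ 2)⁻¹ := by
    have hadd : s + t * Complex.I - α i ≠ 1 := fun h => hs i (by
      rw [re_sub_one_add, sub_eq_zero]
      simpa using congr(($h).re))
    have hsub : s - t * Complex.I - α i ≠ 1 := fun h => hs i (by
      rw [re_sub_one_add, sub_eq_zero]
      simpa using congr(($h).re))
    rw [eq_mul_inv_iff_mul_eq₀ (sq_add_sq_ne_zero (hs i) t), sq_add_sq_eq_mul,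
      regularizedZeta_of_ne_one hadd, regularizedZeta_of_ne_one hsub]
    ring
  rw [contIntegrand, regularKernel, mul_assoc, ← Finset.prod_mul_distrib,
    spectralWeight_of_ne_zero H (by simpa using ht), Finset.prod_congr rfl fun i _ => hΛ i]
  ring

lemma contIntegrand_ae_eq {α : Fin 3 → ℂ} {s : ℂ} (hs : ∀ i, (s - (1 + α i)).re ≠ 0)
    (H : ℂ → ℂ) :
    (fun t : ℝ => contIntegrand α H s (t * Complex.I)) =ᵐ[volume] fun t : ℝ =>
      regularKernel α H s (t * Complex.I) * ∏ i, ((s - (1 + α i)) ^ 2 + (t : ℂ) ^ 2)⁻¹ := by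
  filter_upwards [Measure.ae_ne volume 0] with t ht
    using contIntegrand_eq_regularKernel_mul hs H ht

lemma contSpectrum_eq_polarIntegral {α : Fin 3 → ℂ} {s : ℂ} (hs : ∀ i, (s - (1 + α i)).re ≠ 0)
    (H : ℂ → ℂ) : contSpectrum α H s = (2 * (Real.pi : ℂ))⁻¹ * polarIntegral α H .univ s := by
  rw [contSpectrum, integral_mul_const, integral_congr_ae (contIntegrand_ae_eq hs H),
    ← polarIntegral]
  field_simp [Complex.I_ne_zero]

section ContSpectrum

variable {η : ℝ} {α : Fin 3 → ℂ} {H : ℂ → ℂ} {s s₀ : ℂ}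

lemma integrable_contIntegrand (hH : IsTestFunction η H) (hη : 0 < η)
    (hs : ∀ j, 0 < (s - α j).re) (hne : ∀ i, (s - (1 + α i)).re ≠ 0) :
    Integrable fun t : ℝ => contIntegrand α H s (t * Complex.I) :=
  (integrable_polar_integrand hH hη hs fun i _ => hne i).congr (contIntegrand_ae_eq hne H).symm

lemma analyticAt_contSpectrum (hH : IsTestFunction η H) (hη : 0 < η)
    (hs₀ : ∀ j, 0 < (s₀ - α j).re) (hne : ∀ i, (s₀ - (1 + α i)).re ≠ 0) :
    AnalyticAt ℂ (contSpectrum α H) s₀ := by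
  have hne' : ∀ i ∈ Finset.univ, (s₀ - (1 + α i)).re ≠ 0 := fun i _ => hne i
  have hscaled : AnalyticAt ℂ (fun s => (2 * (Real.pi : ℂ))⁻¹ * polarIntegral α H .univ s) s₀ :=
    analyticAt_const.mul (analyticAt_polarIntegral hH hη hs₀ hne')
  refine hscaled.congr ?_
  filter_upwards [eventually_re_sub_ne_zero hne'] with s hs
  exact (contSpectrum_eq_polarIntegral (fun i => hs i (Finset.mem_univ i)) H).symm

end ContSpectrum

lemma prod_inv_add_eq_sum {F ι : Type*} [Field F] [DecidableEq ι] {S : Finset ι}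
    (hS : S.Nonempty) {v : ι → F} (hv : Set.InjOn v S) {x : F} (hx : ∀ i ∈ S, v i + x ≠ 0) :
    ∏ i ∈ S, (v i + x)⁻¹ = ∑ i ∈ S, (∏ j ∈ S.erase i, (v j - v i)⁻¹) * (v i + x)⁻¹ := by
  have hnode : ∀ i ∈ S, x ≠ -v i := fun i hi h => hx i hi (by rw [h, add_neg_cancel])
  have hlag := Lagrange.eval_interpolate_not_at_node 1 hnode
  rw [Lagrange.interpolate_one (fun i hi j hj hij => hv hi hj (neg_injective hij)) hS,
    Polynomial.eval_one, Lagrange.eval_nodal] at hlag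
  simp only [Lagrange.nodalWeight, sub_neg_eq_add, neg_add_eq_sub, Pi.one_apply, mul_one,
    add_comm x] at hlag
  rw [Finset.prod_inv_distrib, inv_eq_of_mul_eq_one_right hlag.symm]

lemma sq_sub_sq_eq_mul (s a b : ℂ) :
    (s - (1 + a)) ^ 2 - (s - (1 + b)) ^ 2 = (1 + b - a - 1) * (2 * s - 1 - b - a - 1) := by
  ring

lemma eventually_injective_sq_sub {ι : Type*} [Finite ι] {α : ι → ℂ}
    (hα : Function.Injective α) (s₀ : ℂ) :
    ∀ᶠ s in 𝓝[≠] s₀, Function.Injective fun i => (s - (1 + α i)) ^ 2 := by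
  have hne (i j : ι) : ∀ᶠ s in 𝓝[≠] s₀, s ≠ 1 + (α i + α j) / 2 :=
    (eventually_cofinite_ne _).filter_mono (nhdsNE_le_cofinite s₀)
  filter_upwards [eventually_all.mpr fun i => eventually_all.mpr (hne i)] with s hs i j hij
  rw [← sub_eq_zero, sq_sub_sq_eq_mul, mul_eq_zero] at hij
  rcases hij with hij | hij
  · exact hα (by linear_combination -hij)
  · exact absurd (by linear_combination hij / 2) (hs i j)

lemma eventually_regularizedZeta_pole_ne_zero {ι : Type*} [Finite ι] (α : ι → ℂ) (s₀ : ℂ) :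
    ∀ᶠ s in 𝓝[≠] s₀, ∀ i, regularizedZeta (1 + 2 * (s - (1 + α i))) ≠ 0 := by
  refine eventually_all.mpr fun i => ?_
  have hderiv : HasDerivAt (fun s => 1 + 2 * (s - (1 + α i))) (2 * 1) s₀ :=
    (((hasDerivAt_id s₀).sub_const _).const_mul 2).const_add 1
  exact (hderiv.tendsto_nhdsNE (by norm_num)).eventually (eventually_regularizedZeta_ne_zero _)

lemma spectralWeight_mul_regularizedZeta (H : ℂ → ℂ) {μ : ℂ} (hμ : μ ≠ 0)
    (hz : regularizedZeta (1 + 2 * μ) ≠ 0) :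
    spectralWeight H μ * regularizedZeta (1 + 2 * μ) =
      2 * μ * H μ / completedRiemannZeta (1 - 2 * μ) := by
  rw [regularizedZeta_of_ne_one (by simpa using hμ), add_sub_cancel_left] at hz ⊢
  have hΛ := right_ne_zero_of_mul hz
  rw [spectralWeight_of_ne_zero H hμ]
  field_simp

section PartialFractions

variable {ι : Type*} [Fintype ι] [DecidableEq ι]

/-- The coefficient of `((s - 1 - α i)² + x)⁻¹` in the partial fraction expansion of
`∏ i, ((s - 1 - α i)² + x)⁻¹` as a function of `x`. -/
noncomputable def partialFractionCoeff (α : ι → ℂ) (i : ι) (s : ℂ) : ℂ :=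
  ∏ j ∈ Finset.univ.erase i, ((s - (1 + α j)) ^ 2 - (s - (1 + α i)) ^ 2)⁻¹

lemma meromorphicAt_partialFractionCoeff (α : ι → ℂ) (i : ι) (s₀ : ℂ) :
    MeromorphicAt (partialFractionCoeff α i) s₀ :=
  MeromorphicAt.fun_prod fun j _ => by fun_prop

/-- The contribution to the continuous spectrum of the poles `μ = ±(s - 1 - α i)`, continued
across the line where they meet the path of integration. -/
noncomputable def crossTerm (α : ι → ℂ) (H : ℂ → ℂ) (i : ι) (s : ℂ) : ℂ :=
  partialFractionCoeff α i s / (2 * Real.pi) * (regularPolarIntegral α H i s +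
    Real.pi * regularKernel α H s (s - (1 + α i)) / (s - (1 + α i)))

/-- The `i`-th summand of `residualTerm`, for an arbitrary finite family of parameters. -/
noncomputable def residualSummand (α : ι → ℂ) (H : ℂ → ℂ) (i : ι) (s : ℂ) : ℂ :=
  2 * (H (1 - s + α i) * (∏ j ∈ Finset.univ.erase i,
      completedRiemannZeta (1 + α i - α j) * completedRiemannZeta (2 * s - 1 - α i - α j)) /
    completedRiemannZeta (3 - 2 * s + 2 * α i))

variable {η : ℝ} {α : ι → ℂ} {H : ℂ → ℂ} {s s₀ : ℂ} {i : ι}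

lemma polarIntegral_univ_eq_sum [Nonempty ι] (hH : IsTestFunction η H) (hη : 0 < η)
    (hs : ∀ j, 0 < (s - α j).re) (hne : ∀ i, (s - (1 + α i)).re ≠ 0)
    (hinj : Function.Injective fun i => (s - (1 + α i)) ^ 2) :
    polarIntegral α H .univ s = ∑ i, partialFractionCoeff α i s * polarIntegral α H {i} s := by
  simp only [polarIntegral, ← integral_const_mul]
  rw [← integral_finsetSum _ fun i _ =>
    (integrable_polar_integrand hH hη hs (by simpa using hne i)).const_mul _]
  congr 1 with t
  rw [prod_inv_add_eq_sum Finset.univ_nonempty hinj.injOn fun i _ => sq_add_sq_ne_zero (hne i) t,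
    Finset.mul_sum]
  refine Finset.sum_congr rfl fun i _ => ?_
  rw [Finset.prod_singleton, partialFractionCoeff]
  ring

lemma crossTerm_of_re_pos (hH : IsTestFunction η H) (hη : 0 < η) (hs : ∀ j, 0 < (s - α j).re)
    (hi : 0 < (s - (1 + α i)).re) :
    crossTerm α H i s = partialFractionCoeff α i s / (2 * Real.pi) * polarIntegral α H {i} s := by
  rw [crossTerm, regularPolarIntegral_eq_sub hH hη hs hi.ne', integral_univ_inv_sq_add_sq hi]
  ring

lemma crossTerm_of_re_neg (hH : IsTestFunction η H) (hη : 0 < η) (hs : ∀ j, 0 < (s - α j).re)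
    (hi : (s - (1 + α i)).re < 0) :
    crossTerm α H i s = partialFractionCoeff α i s / (2 * Real.pi) * polarIntegral α H {i} s +
      partialFractionCoeff α i s * regularKernel α H s (s - (1 + α i)) / (s - (1 + α i)) := by
  rw [crossTerm, regularPolarIntegral_eq_sub hH hη hs hi.ne, integral_univ_inv_sq_add_sq_of_neg hi]
  field_simp
  ring

theorem meromorphicAt_crossTerm (hH : IsTestFunction η H) (hη : 1 / 2 ≤ η)
    (hs₀ : ∀ j, 0 < (s₀ - α j).re) (i : ι) : MeromorphicAt (crossTerm α H i) s₀ := by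
  have hη0 : 0 < η := by linarith
  have hcoeff : MeromorphicAt (fun s => partialFractionCoeff α i s / (2 * Real.pi)) s₀ :=
    (meromorphicAt_partialFractionCoeff α i s₀).fun_div (.const _ _)
  have hpolar (hne : (s₀ - (1 + α i)).re ≠ 0) : MeromorphicAt (polarIntegral α H {i}) s₀ :=
    (analyticAt_polarIntegral hH hη0 hs₀ (by simpa using hne)).meromorphicAt
  have hres (hle : (s₀ - (1 + α i)).re ≤ 0) :
      MeromorphicAt (fun s => regularKernel α H s (s - (1 + α i))) s₀ := by
    refine meromorphicAt_regularKernel hH (by fun_prop) (by fun_prop) (abs_lt.mpr ⟨?_, by linarith⟩)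
    rw [re_sub_one_add]
    linarith [hs₀ i]
  have hpole : MeromorphicAt (fun s => s - (1 + α i)) s₀ := by fun_prop
  rcases lt_trichotomy (s₀ - (1 + α i)).re 0 with hlt | hzero | hgt
  · refine ((hcoeff.fun_mul (hpolar hlt.ne)).fun_add
      (((meromorphicAt_partialFractionCoeff α i s₀).fun_mul (hres hlt.le)).fun_div
        hpole)).congr (EventuallyEq.filter_mono ?_ nhdsWithin_le_nhds)
    filter_upwards [eventually_re_sub_pos hs₀,
      (isOpen_lt (f := fun s : ℂ => (s - (1 + α i)).re) (by fun_prop)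
        continuous_const).mem_nhds hlt] with s hs hi
    exact (crossTerm_of_re_neg hH hη0 hs hi).symm
  · exact hcoeff.fun_mul ((analyticAt_regularPolarIntegral hH hη0 hs₀ hzero).meromorphicAt.fun_add
      (((MeromorphicAt.const _ _).fun_mul (hres hzero.le)).fun_div hpole))
  · refine (hcoeff.fun_mul (hpolar hgt.ne')).congr (EventuallyEq.filter_mono ?_ nhdsWithin_le_nhds)
    filter_upwards [eventually_re_sub_pos hs₀,
      (isOpen_lt (g := fun s : ℂ => (s - (1 + α i)).re) continuous_const
        (by fun_prop)).mem_nhds hgt] with s hs hi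
    exact (crossTerm_of_re_pos hH hη0 hs hi).symm

lemma partialFractionCoeff_mul_prod
    (hinj : Function.Injective fun i => (s - (1 + α i)) ^ 2) (i : ι) :
    partialFractionCoeff α i s * ∏ j ∈ Finset.univ.erase i,
      regularizedZeta (1 + α i - α j) * regularizedZeta (2 * s - 1 - α i - α j) =
      ∏ j ∈ Finset.univ.erase i,
        completedRiemannZeta (1 + α i - α j) * completedRiemannZeta (2 * s - 1 - α i - α j) := by
  rw [partialFractionCoeff, ← Finset.prod_mul_distrib]
  refine Finset.prod_congr rfl fun j hj => ?_
  have hne : (s - (1 + α j)) ^ 2 - (s - (1 + α i)) ^ 2 ≠ 0 :=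
    sub_ne_zero.mpr (hinj.ne (Finset.ne_of_mem_erase hj))
  rw [inv_mul_eq_iff_eq_mul₀ hne]
  rw [sq_sub_sq_eq_mul] at hne ⊢
  rw [regularizedZeta_of_ne_one (sub_ne_zero.mp (left_ne_zero_of_mul hne)),
    regularizedZeta_of_ne_one (sub_ne_zero.mp (right_ne_zero_of_mul hne))]
  ring

lemma regularKernel_pole (α : ι → ℂ) (H : ℂ → ℂ) (i : ι) (s : ℂ) :
    regularKernel α H s (s - (1 + α i)) =
      spectralWeight H (s - (1 + α i)) * regularizedZeta (1 + 2 * (s - (1 + α i))) *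
        ∏ j ∈ Finset.univ.erase i,
          regularizedZeta (1 + α i - α j) * regularizedZeta (2 * s - 1 - α i - α j) := by
  have hi : regularizedZeta (s + (s - (1 + α i)) - α i) *
      regularizedZeta (s - (s - (1 + α i)) - α i) = regularizedZeta (1 + 2 * (s - (1 + α i))) := by
    rw [show s - (s - (1 + α i)) - α i = 1 by ring, regularizedZeta_one, mul_one]
    ring_nf
  rw [regularKernel, ← Finset.mul_prod_erase _ _ (Finset.mem_univ i), hi, ← mul_assoc]
  congr 1
  refine Finset.prod_congr rfl fun j _ => ?_
  rw [mul_comm]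
  ring_nf

lemma residualSummand_eq (hH : IsTestFunction η H) (hre : |(s - (1 + α i)).re| < 2 * η)
    (hp : s - (1 + α i) ≠ 0) (hz : regularizedZeta (1 + 2 * (s - (1 + α i))) ≠ 0)
    (hinj : Function.Injective fun i => (s - (1 + α i)) ^ 2) :
    residualSummand α H i s = partialFractionCoeff α i s *
      regularKernel α H s (s - (1 + α i)) / (s - (1 + α i)) := by
  have hHp : H (1 - s + α i) = H (s - (1 + α i)) := by
    rw [← hH.even _ hre]
    ring_nf
  rw [residualSummand, hHp, ← partialFractionCoeff_mul_prod hinj, regularKernel_pole,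
    spectralWeight_mul_regularizedZeta H hp hz,
    show 3 - 2 * s + 2 * α i = 1 - 2 * (s - (1 + α i)) by ring]
  field_simp

end PartialFractions

lemma residualTerm_eq_sum (α : Fin 3 → ℂ) (H : ℂ → ℂ) (s : ℂ) :
    residualTerm α H s = ∑ i, residualSummand α H i s := by
  simp only [residualTerm, residualSummand, Finset.mul_sum]

/-- The continuous spectrum, corrected by the residues at the poles that have crossed the line
`Re μ = 0`. If some pole lies on that line, the integral diverges and the value is expressed
through the continued contributions of the individual poles instead. -/
noncomputable def continuedSpectrum (α : Fin 3 → ℂ) (H : ℂ → ℂ) (s : ℂ) : ℂ :=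
  if ∀ i, (s - (1 + α i)).re ≠ 0 then
    contSpectrum α H s + ∑ i with (s - (1 + α i)).re < 0, residualSummand α H i s
  else ∑ i, crossTerm α H i s

section ContinuedSpectrum

variable {η : ℝ} {α : Fin 3 → ℂ} {H : ℂ → ℂ} {s s₀ : ℂ}

lemma continuedSpectrum_of_re_pos (H : ℂ → ℂ) (hs : ∀ i, 0 < (s - (1 + α i)).re) :
    continuedSpectrum α H s = contSpectrum α H s := by
  rw [continuedSpectrum, if_pos fun i => (hs i).ne',
    Finset.filter_false_of_mem fun i _ => (hs i).not_gt, Finset.sum_empty, add_zero]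

lemma continuedSpectrum_of_re_neg (H : ℂ → ℂ) (hs : ∀ i, (s - (1 + α i)).re < 0) :
    continuedSpectrum α H s = residualTerm α H s + contSpectrum α H s := by
  rw [continuedSpectrum, if_pos fun i => (hs i).ne, Finset.filter_true_of_mem fun i _ => hs i,
    residualTerm_eq_sum, add_comm]

lemma continuedSpectrum_eq_sum_crossTerm (hH : IsTestFunction η H) (hη : 1 / 2 ≤ η)
    (hs : ∀ j, 0 < (s - α j).re) (hinj : Function.Injective fun i => (s - (1 + α i)) ^ 2)
    (hz : ∀ i, regularizedZeta (1 + 2 * (s - (1 + α i))) ≠ 0) :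
    continuedSpectrum α H s = ∑ i, crossTerm α H i s := by
  have hη0 : 0 < η := by linarith
  rw [continuedSpectrum]
  split_ifs with hne
  · rw [contSpectrum_eq_polarIntegral hne, polarIntegral_univ_eq_sum hH hη0 hs hne hinj,
      Finset.mul_sum, Finset.sum_filter, ← Finset.sum_add_distrib]
    refine Finset.sum_congr rfl fun i _ => ?_
    rcases lt_or_gt_of_ne (hne i) with hneg | hpos
    · have hre : |(s - (1 + α i)).re| < 2 * η := by
        rw [abs_of_neg hneg, re_sub_one_add]
        linarith [hs i]
      have hp : s - (1 + α i) ≠ 0 := fun h => hne i (by rw [h, Complex.zero_re])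
      rw [if_pos hneg, crossTerm_of_re_neg hH hη0 hs hneg, residualSummand_eq hH hre hp (hz i) hinj]
      ring
    · rw [if_neg hpos.not_gt, crossTerm_of_re_pos hH hη0 hs hpos]
      ring
  · rfl

theorem meromorphicAt_continuedSpectrum (hH : IsTestFunction η H) (hη : 1 / 2 ≤ η)
    (hα : Function.Injective α) (hs₀ : ∀ j, 0 < (s₀ - α j).re) :
    MeromorphicAt (continuedSpectrum α H) s₀ := by
  have hsum : MeromorphicAt (fun s => ∑ i, crossTerm α H i s) s₀ :=
    .fun_sum fun i _ => meromorphicAt_crossTerm hH hη hs₀ i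
  refine hsum.congr ?_
  filter_upwards [nhdsWithin_le_nhds (eventually_re_sub_pos hs₀), eventually_injective_sq_sub hα s₀,
    eventually_regularizedZeta_pole_ne_zero α s₀] with s hs hinj hz
  exact (continuedSpectrum_eq_sum_crossTerm hH hη hs hinj hz).symm

theorem isMeromorphicContinuation_continuedSpectrum {ε : ℝ} (hε : ε ≤ 1 / 2)
    (hη : 1 / 2 ≤ η) (hα : Function.Injective α) (hα_re : ∀ i, |(α i).re| < ε)
    (hH : IsTestFunction η H) :
    IsMeromorphicContinuation (contSpectrum α H) {s : ℂ | ∀ i, 1 + (α i).re < s.re}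
      (continuedSpectrum α H) {s : ℂ | ε < s.re} where
  isOpen_source := by
    simp only [Set.ofPred_forall]
    exact isOpen_iInter_of_finite fun i => isOpen_lt continuous_const Complex.continuous_re
  nonempty_source := by
    refine ⟨2, fun i => ?_⟩
    rw [Complex.re_ofNat]
    linarith [lt_of_abs_lt (hα_re i)]
  isOpen_target := isOpen_lt continuous_const Complex.continuous_re
  isPreconnected_target := (convex_halfSpace_re_gt ε).isPreconnected
  subset s hs := by
    simp only [Set.mem_ofPred_eq]
    linarith [hs 0, neg_lt_of_abs_lt (hα_re 0)]
  holomorphic s hs := by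
    have hpos (i : Fin 3) : 0 < (s - (1 + α i)).re := by simpa using hs i
    have hpos' (i : Fin 3) : 0 < (s - α i).re := by
      linarith [hpos i, re_sub_one_add s (α i)]
    exact (analyticAt_contSpectrum hH (by linarith) hpos'
      fun i => (hpos i).ne').differentiableAt.differentiableWithinAt
  meromorphic s hs := meromorphicAt_continuedSpectrum hH hη hα fun i => by
    rw [Complex.sub_re]
    linarith [lt_of_abs_lt (hα_re i), Set.mem_ofPred_eq ▸ hs]
  eqOn s hs := continuedSpectrum_of_re_pos H fun i => by simpa using hs i

end ContinuedSpectrum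

theorem mainTheorem7_general {ε η : ℝ} (hε : ε ≤ 1 / 2) (hη : 1 / 2 ≤ η) {α : Fin 3 → ℂ}
    (hα : Function.Injective α) (hα_re : ∀ i, |(α i).re| < ε) {H : ℂ → ℂ}
    (hH : IsTestFunction η H) :
    (∀ s : ℂ, ((∀ i, 1 + (α i).re < s.re) ∨ (ε < s.re ∧ s.re < 1 - ε)) →
      Integrable (fun t : ℝ => contIntegrand α H s ((t : ℂ) * Complex.I))) ∧
    ∃ F : ℂ → ℂ,
      IsMeromorphicContinuation (contSpectrum α H) {s : ℂ | ∀ i, 1 + (α i).re < s.re}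
        F {s : ℂ | ε < s.re} ∧
      ∀ s : ℂ, ε < s.re → s.re < 1 - ε → (∀ i j, i ≠ j → s ≠ (1 + α i + α j) / 2) →
        F s = residualTerm α H s + contSpectrum α H s := by
  have hη0 : 0 < η := by linarith
  have hcont := isMeromorphicContinuation_continuedSpectrum hε hη hα hα_re hH
  have hneg (s : ℂ) (hs : s.re < 1 - ε) (i : Fin 3) : (s - (1 + α i)).re < 0 := by
    rw [re_sub_one_add, Complex.sub_re]
    linarith [neg_lt_of_abs_lt (hα_re i)]
  have hpos (s : ℂ) (hs : ε < s.re) (j : Fin 3) : 0 < (s - α j).re := by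
    rw [Complex.sub_re]
    linarith [lt_of_abs_lt (hα_re j)]
  refine ⟨?_, continuedSpectrum α H, hcont,
    fun s _ hs _ => continuedSpectrum_of_re_neg H (hneg s hs)⟩
  rintro s (hs | ⟨hs, hs'⟩)
  · exact integrable_contIntegrand hH hη0 (hpos s (hcont.subset hs)) fun i => by
      simpa [sub_ne_zero] using (hs i).ne'
  · exact integrable_contIntegrand hH hη0 (hpos s hs) fun i => (hneg s hs' i).ne

lemma abs_re_lt_of_sum_eq_zero {α : Fin 3 → ℂ} (hsum : α 0 + α 1 + α 2 = 0) {r : ℝ}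
    (hzero : ‖α 0‖ < r) (hone : ‖α 1‖ < r) (i : Fin 3) : |(α i).re| < 2 * r := by
  have htwo : ‖α 2‖ ≤ ‖α 0‖ + ‖α 1‖ := by
    rw [show α 2 = -(α 0 + α 1) by linear_combination hsum, norm_neg]
    exact norm_add_le _ _
  have hr : 0 < r := (norm_nonneg _).trans_lt hzero
  refine (Complex.abs_re_le_norm _).trans_lt ?_
  fin_cases i <;> simp only [Fin.zero_eta, Fin.mk_one, Fin.reduceFinMk] <;> linarith

lemma exists_add_eq_neg_of_sum_eq_zero {α : Fin 3 → ℂ} (hsum : α 0 + α 1 + α 2 = 0) {i j : Fin 3}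
    (hij : i ≠ j) : ∃ k, α i + α j = -α k := by
  obtain ⟨k, hki, hkj⟩ : ∃ k, k ≠ i ∧ k ≠ j := by
    decide +revert
  have huniv : (Finset.univ : Finset (Fin 3)) = {i, j, k} := by
    decide +revert
  have hijk : α i + (α j + α k) = 0 := by
    rw [← hsum, ← Fin.sum_univ_three, huniv, Finset.sum_insert (by simp [hij, hki.symm]),
      Finset.sum_pair hkj.symm]
  exact ⟨k, by linear_combination hijk⟩

theorem mainTheorem7 (ε : ℝ) (hε : ε = 1 / 100) (η : ℝ) (hη : 40 < η)
    (α : Fin 3 → ℂ) (hα_distinct : Function.Injective α) (hα_sum : α 0 + α 1 + α 2 = 0)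
    (hα_zero : ‖α 0‖ < ε / 1000) (hα_one : ‖α 1‖ < ε / 1000)
    (H : ℂ → ℂ) (hH : IsTestFunction η H) :
    (∀ s : ℂ, ((∀ i, 1 + (α i).re < s.re) ∨ (ε < s.re ∧ s.re < 1 - ε)) →
      MeasureTheory.Integrable (fun t : ℝ => contIntegrand α H s ((t : ℂ) * Complex.I))) ∧
    ∃ F : ℂ → ℂ,
      IsMeromorphicContinuation (contSpectrum α H) {s : ℂ | ∀ i, 1 + (α i).re < s.re}
        F {s : ℂ | ε < s.re} ∧
      ∀ s : ℂ, ε < s.re → s.re < 1 - ε → (∀ k, s ≠ (1 - α k) / 2) →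
        F s = residualTerm α H s + contSpectrum α H s := by
  have hα_re (i : Fin 3) : |(α i).re| < ε := by
    linarith [abs_re_lt_of_sum_eq_zero hα_sum hα_zero hα_one i]
  obtain ⟨hint, F, hF, heq⟩ :=
    mainTheorem7_general (by linarith) (by linarith) hα_distinct hα_re hH
  refine ⟨hint, F, hF, fun s hs hs' hne => heq s hs hs' fun i j hij => ?_⟩
  obtain ⟨k, hk⟩ := exists_add_eq_neg_of_sum_eq_zero hα_sum hij
  rw [add_assoc, hk, ← sub_eq_add_neg]
  exact hne k
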